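/- Let $K$ be a field of characteristic zero, $d\ge 0$, and let $\mathcal I$ (kernels, with regularities $\beta_i\in\mathbb R$) and $\Xi$ (noises, with regularities $\alpha_\xi\in\mathbb R$) be index sets. **Trees.** Let $\mathfrak T$ be the $K$-vector space with basis the planar rooted trees with vertices decorated by $\mathbb N^d$ and edges decorated by $(\mathcal I\cup\Xi)\times\mathbb N^d$, such that each vertex has at most one outgoing noise edge (an edge with decoration in $\Xi\times\mathbb N^d$) and each noise vertex (a vertex with an incoming noise edge) is a leaf. Write $X^n\omega$ for the tree with root decoration $n$ and ordered list of outgoing planted branches $\omega$. The regularity $|\tau|$ is the sum of $|n|$ over all vertex decorations $n$, of $\beta_i-|a|$ over kernel edges $(i,a)$ and of $\alpha_\xi-1-|a|$ over noise edges $(\xi,a)$. Let $\mathfrak T^-$ be the span of the trees with $|\tau|<0$ and $S(\mathfrak T^-)$ its symmetric algebra. **The action $\ast_+$.** For trees $X^m\omega$, without noise edge at the root, and $y$, let $(X^m\omega)\ast_+y\in\mathfrak T$ be the sum over all ways to graft the branches of $\omega$ onto non-noise vertices of $y$ (the root included), to the left of the existing branches and with branches at the same vertex keeping their order. Each grafting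 is deformed: for a vertex with decoration $n$ that receives branches with edge decorations $a_1,\dots,a_k$ one sums over $\ell_1,\dots,\ell_k\in\mathbb N^d$ with $\ell_j\le a_j$ and $\sum_j\ell_j\le n$, replaces $a_j$ by $a_j-\ell_j$ and $n$ by $n-\sum_j\ell_j$, with weight $\frac{n!}{\ell_1!\cdots\ell_k!\,(n-\sum_j\ell_j)!}$. Afterwards $m$ is distributed in all ways over the decorations of the non-noise vertices of $y$, with multinomial weight. **Deformed insertion.** For $\tau\in\mathfrak T^-$ and a tree $t$ let $\tau\mathbin{\hat\diamond}t$ be the sum over the vertices $v$ of $t$ not adjacent to a noise edge of the trees obtained by replacing the subtree $P_v$ of $t$ above $v$ (with root $v$) by $P_v\ast_+\tau$; let $\hat\diamond_{\rm nr}$ be the same sum over the vertices $v$ different from the root. Both extend to products of elements of $\mathfrak T^-$ by the Guin--Oudom rule $(\tau\omega)\mathbin{\hat\diamond}t=\tau\mathbin{\hat\diamond}(\omega\mathbin{\hat\diamond}t)-(\tau\mathbin{\hat\diamond}\omega)\mathbin{\hat\diamond}t$, respectively $(\tau\omega)\mathbin{\hat\diamond}_{\rm nr}t=\tau\mathbin{\hat\diamond}_{\rm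 nr}(\omega\mathbin{\hat\diamond}_{\rm nr}t)-(\tau\mathbin{\hat\diamond}\omega)\mathbin{\hat\diamond}_{\rm nr}t$, where $\tau\mathbin{\hat\diamond}(\cdot)$ acts on products of trees as a derivation. **Coactions.** With respect to the bilinear pairings for which the basis of trees is orthonormal, extended to $S(\mathfrak T^-)$ by $\langle\sigma_1\cdots\sigma_n,\tau_1\cdots\tau_n\rangle=\sum_\pi\prod_i\langle\sigma_i,\tau_{\pi(i)}\rangle$ (sum over permutations; products of different lengths are orthogonal), let $\Delta^+_0:\mathfrak T\to\mathfrak T\,\overline\otimes\,\mathfrak T$ be the dual of $\ast_+$ (the left tensor factors have no noise edge at the root, no condition on their regularity), and let $\Delta^-$ and $\Delta^-_{\text{non-root}}$ be the duals of the actions $\hat\diamond$ and $\hat\diamond_{\rm nr}$ of $S(\mathfrak T^-)$ on $\mathfrak T$. Here $\overline\otimes$ is the completed tensor product, i.e. formal infinite linear combinations of tensors of basis elements. Put $m^{1,3}(a\otimes b\otimes c\otimes e)=ac\otimes b\otimes e$. **Statement.** The two actions of products of trees in $\mathfrak T^-$ do not depend on the order of the factors; $\Delta^-$ and $\Delta^-_{\text{non-root}}$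 are well-defined maps $\mathfrak T\to S(\mathfrak T^-)\otimes\mathfrak T$ (with values in the algebraic tensor product); the maps ${\rm Id}\otimes\Delta^+_0$ and $\Delta^-_{\text{non-root}}\otimes\Delta^-$ extend to formal infinite linear combinations, each coefficient of the result being a finite sum; and $$({\rm Id}\otimes\Delta^+_0)\,\Delta^- \;=\; m^{1,3}\,(\Delta^-_{\text{non-root}}\otimes\Delta^-)\,\Delta^+_0\qquad\text{on }\mathfrak T .$$ -/

import Mathlib

noncomputable section

namespace PlanarRS

/-- Planted forests: ordered lists (from left to right) of planted branches.  A branch is either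

* a noise edge with decoration `(ξ, a)` leading to a noise vertex with decoration `k` (a noise vertex
  has no outgoing edges), or
* a kernel edge with decoration `(i, a)` leading to a vertex with decoration `n`, whose own outgoing
  branches form the planted forest `sub`.

`d` is the number of components of the decorations, `κ` indexes the kernels, `ι` the noises. -/
inductive Forest (d : ℕ) (κ ι : Type*)
  | nil : Forest d κ ι
  | noise (ξ : ι) (a k : Fin d → ℕ) (rest : Forest d κ ι) : Forest d κ ι
  | kernel (i : κ) (a n : Fin d → ℕ) (sub rest : Forest d κ ι) : Forest d κ ι

/-- The planar decorated tree `X^n ω`: the root has decoration `n` and outgoing branches `ω`. -/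
abbrev PTree (d : ℕ) (κ ι : Type*) := (Fin d → ℕ) × Forest d κ ι

namespace Forest

variable {d : ℕ} {κ ι : Type*}

/-- Concatenation, i.e. merging two planted forests at their roots. -/
def append : Forest d κ ι → Forest d κ ι → Forest d κ ι
  | nil, η => η
  | noise ξ a k r, η => noise ξ a k (append r η)
  | kernel i a n s r, η => kernel i a n s (append r η)

/-- The number of noise edges that are outgoing from the root. -/
def rootNoise : Forest d κ ι → ℕ
  | nil => 0
  | noise _ _ _ r => rootNoise r + 1
  | kernel _ _ _ _ r => rootNoise r

/-- Every vertex has at most one outgoing noise edge. -/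
def Valid : Forest d κ ι → Prop
  | nil => True
  | noise _ _ _ r => rootNoise r = 0 ∧ Valid r
  | kernel _ _ _ s r => Valid s ∧ Valid r

/-- The deshuffle coproduct: all ways to split the branches into two ordered sublists. -/
def deshuffle : Forest d κ ι → List (Forest d κ ι × Forest d κ ι)
  | nil => [(nil, nil)]
  | noise ξ a k r =>
      (deshuffle r).map (fun p => (noise ξ a k p.1, p.2)) ++
      (deshuffle r).map (fun p => (p.1, noise ξ a k p.2))
  | kernel i a n s r =>
      (deshuffle r).map (fun p => (kernel i a n s p.1, p.2)) ++
      (deshuffle r).map (fun p => (p.1, kernel i a n s p.2))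

/-- Regularity of a planted forest: a kernel edge `(i, a)` contributes `β i - |a|`, a noise edge
`(ξ, a)` contributes `α ξ - 1 - |a|`, a vertex with decoration `n` contributes `|n|`. -/
def reg (β : κ → ℝ) (α : ι → ℝ) : Forest d κ ι → ℝ
  | nil => 0
  | noise ξ a k r => (α ξ - 1 - ∑ j, (a j : ℝ)) + (∑ j, (k j : ℝ)) + reg β α r
  | kernel i a n s r =>
      (β i - ∑ j, (a j : ℝ)) + (∑ j, (n j : ℝ)) + reg β α s + reg β α r

end Forest

open Forest

section Trees

variable {d : ℕ} {κ ι : Type*}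

/-- Regularity of the tree `X^n ω`. -/
def reg (β : κ → ℝ) (α : ι → ℝ) (t : PTree d κ ι) : ℝ := (∑ j, (t.1 j : ℝ)) + t.2.reg β α

variable (d κ ι) in
/-- The basis of the model space: trees in which every vertex has at most one outgoing noise edge
(and noise vertices have no outgoing edge). -/
abbrev Tree := {t : PTree d κ ι // t.2.Valid}

variable (d) in
/-- The basis of the space of trees of negative regularity. -/
abbrev NegTree {κ ι : Type*} (β : κ → ℝ) (α : ι → ℝ) :=
  {t : PTree d κ ι // t.2.Valid ∧ reg β α t < 0}

variable (d) in
/-- The monomial basis of the symmetric algebra over the space of trees of negative regularity. -/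
abbrev NegMon {κ ι : Type*} (β : κ → ℝ) (α : ι → ℝ) := NegTree d β α →₀ ℕ

/-- Multi-index binomial coefficient. -/
def mchoose (m l : Fin d → ℕ) : ℕ := ∏ j, (m j).choose (l j)

end Trees

section Products

variable (K : Type*) [Field K] {d : ℕ} {κ ι : Type*}

/-- Deformed grafting of all branches of a planted forest onto one vertex with decoration `n`:
every branch, with edge decoration `a`, is individually deformed by an `ℓ ≤ a` that is subtracted
from `a` and from the vertex decoration, weighted by a binomial coefficient.  The result consists of
the new vertex decoration and the deformed branches.  Noise edges cannot be grafted. -/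
def attach : Forest d κ ι → (Fin d → ℕ) → (PTree d κ ι →₀ K)
  | nil, n => Finsupp.single (n, nil) 1
  | noise _ _ _ _, _ => 0
  | kernel i a m s r, n =>
      ∑ l ∈ Finset.Icc 0 (n ⊓ a), (attach r (n - l)).sum fun p c =>
        Finsupp.single (p.1, kernel i (a - l) m s p.2) ((mchoose n l : K) * c)

/-- Deformed grafting of `X^m ω` onto the vertex with decoration `n` at the root of a tree and onto
the remaining tree, where `F` is the deformed grafting onto the non-root vertices.  The splitting of
`X^m ω` is its deshuffle coproduct, and `X^{m₁}` raises the decoration of the vertex. -/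
def graftRoot (F : (Fin d → ℕ) → Forest d κ ι → (Forest d κ ι →₀ K))
    (m : Fin d → ℕ) (ω : Forest d κ ι) (n : Fin d → ℕ) : PTree d κ ι →₀ K :=
  ∑ m₁ ∈ Finset.Icc 0 m, ((deshuffle ω).map fun p =>
    (attach K p.1 n).sum fun q c => (F (m - m₁) p.2).sum fun u e =>
      Finsupp.single (q.1 + m₁, q.2.append u) ((mchoose m m₁ : K) * c * e)).sum

/-- `graftForest K η m ω` is the deformed grafting of `X^m ω` onto the planted forest `η`, i.e. onto
all its non-root non-noise vertices: `X^m ω` is split over the branches of `η` by the deshuffle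
coproduct, nothing is grafted onto a noise vertex. -/
def graftForest : Forest d κ ι → (Fin d → ℕ) → Forest d κ ι → (Forest d κ ι →₀ K)
  | nil, m, nil => if m = 0 then Finsupp.single nil 1 else 0
  | nil, _, _ => 0
  | noise ξ a k r, m, ω => (graftForest r m ω).sum fun u c => Finsupp.single (noise ξ a k u) c
  | kernel i a n s r, m, ω =>
      ∑ m₁ ∈ Finset.Icc 0 m, ((deshuffle ω).map fun p =>
        (graftRoot K (graftForest s) m₁ p.1 n).sum fun t c =>
          (graftForest r (m - m₁) p.2).sum fun u e =>
            Finsupp.single (kernel i a t.1 t.2 u) ((mchoose m m₁ : K) * c * e)).sum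

/-- The deformed Grossman--Larson action `(X^m ω) ∗₊ (X^n η)`. -/
def glAct (x y : PTree d κ ι) : PTree d κ ι →₀ K :=
  graftRoot K (graftForest K y.2) x.1 x.2 y.1

/-- Deformed insertion of `τ` into the tree `X^n s`, given the sum `F` of the insertions into its
non-root vertices.  Inserting `τ` into a vertex not adjacent to a noise edge identifies the root of
`τ` with the vertex; the outgoing edges of the vertex are deformed-grafted onto `τ` and its
decoration is distributed over `τ`, so that the result is `(X^n s) ∗₊ τ`. -/
def insertRoot (τ : PTree d κ ι) (F : Forest d κ ι →₀ K) (n : Fin d → ℕ) (s : Forest d κ ι) :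
    PTree d κ ι →₀ K :=
  (if s.rootNoise = 0 then glAct K (n, s) τ else 0) + F.sum fun u c => Finsupp.single (n, u) c

/-- Sum of the deformed insertions of `τ` into the non-root vertices of a planted forest. -/
def insertForest (τ : PTree d κ ι) : Forest d κ ι → (Forest d κ ι →₀ K)
  | nil => 0
  | noise ξ a k r => (insertForest τ r).sum fun u c => Finsupp.single (noise ξ a k u) c
  | kernel i a n s r =>
      ((insertRoot K τ (insertForest τ s) n s).sum fun t c =>
        Finsupp.single (kernel i a t.1 t.2 r) c) +
      (insertForest τ r).sum fun u c => Finsupp.single (kernel i a n s u) c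

/-- The deformed insertion of `τ` into `t`: the sum of the insertions into all vertices of `t` that
are not adjacent to a noise edge. -/
def insertion (τ t : PTree d κ ι) : PTree d κ ι →₀ K :=
  insertRoot K τ (insertForest K τ t.2) t.1 t.2

/-- The same, without the insertion into the root of `t`. -/
def insertionNonRoot (τ t : PTree d κ ι) : PTree d κ ι →₀ K :=
  (insertForest K τ t.2).sum fun u c => Finsupp.single (t.1, u) c

/-- Guin--Oudom extension of an insertion `I` to products `τ₀ ⋯ τ_{n-1}` of trees:
`(τ₀ ω) ▹ t = τ₀ ▹ (ω ▹ t) - (τ₀ ▹ ω) ▹ t`, where in `τ₀ ▹ ω` the tree `τ₀` is inserted into the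
factors of `ω` as a derivation, always by the full deformed insertion. -/
def act (I : PTree d κ ι → PTree d κ ι → (PTree d κ ι →₀ K)) :
    (n : ℕ) → (Fin n → PTree d κ ι) → PTree d κ ι → (PTree d κ ι →₀ K)
  | 0, _, t => Finsupp.single t 1
  | n + 1, τ, t =>
      ((act I n (Fin.tail τ) t).sum fun u c => c • I (τ 0) u) -
      ∑ j : Fin n, (insertion K (τ 0) (Fin.tail τ j)).sum fun σ c =>
        c • act I n (Function.update (Fin.tail τ) j σ) t

/-- The action of a monomial of trees of negative regularity; the factors are taken in some order. -/
def actMon {β : κ → ℝ} {α : ι → ℝ} (I : PTree d κ ι → PTree d κ ι → (PTree d κ ι →₀ K))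
    (a : NegMon d β α) (t : PTree d κ ι) : PTree d κ ι →₀ K :=
  act K I (Finsupp.toMultiset a).toList.length (fun i => ((Finsupp.toMultiset a).toList.get i).1) t

end Products

section Coactions

variable (K : Type*) [Field K] {d : ℕ} {κ ι : Type*}

/-- Formal (possibly infinite) linear combinations of the elements of the basis `A`.  Completed
tensor products are the spaces `Ser K (A × B)`. -/
abbrev Ser (A : Type*) := A → K

/-- The recentering coaction without projection onto positive trees: the dual of `∗₊`, whose left
argument has no noise edge at the root, with respect to the bases of trees. -/
def deltaPlusZero (z : Tree d κ ι) : Ser K (Tree d κ ι × Tree d κ ι) := fun p =>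
  if p.1.1.2.rootNoise = 0 then glAct K p.1.1 p.2.1 z.1 else 0

/-- The dual of the action of the symmetric algebra that is generated by the insertion `I`.  The
symmetric algebra is paired with itself by
`⟨σ₁ ⋯ σ_n, τ₁ ⋯ τ_n⟩ = ∑_π ∏ i, ⟨σ_i, τ_{π i}⟩`, so a monomial `∏ τ ^ a τ` has square norm
`∏ (a τ)!`. -/
def dualCoaction (β : κ → ℝ) (α : ι → ℝ) (I : PTree d κ ι → PTree d κ ι → (PTree d κ ι →₀ K))
    (z : Tree d κ ι) : Ser K (NegMon d β α × Tree d κ ι) := fun p =>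
  (p.1.prod fun _ k => (k.factorial : K))⁻¹ * actMon K I p.1 p.2.1 z.1

/-- The deformed coaction for negative renormalisation. -/
def deltaMinus (β : κ → ℝ) (α : ι → ℝ) :
    Tree d κ ι → Ser K (NegMon d β α × Tree d κ ι) :=
  dualCoaction K β α (insertion K)

/-- The variant that does not contract subtrees containing the root. -/
def deltaMinusNonRoot (β : κ → ℝ) (α : ι → ℝ) :
    Tree d κ ι → Ser K (NegMon d β α × Tree d κ ι) :=
  dualCoaction K β α (insertionNonRoot K)

open Classical in
/-- The identity, as a map from a basis to formal linear combinations. -/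
def idMap (A : Type*) : A → Ser K A := fun a b => if a = b then 1 else 0

/-- Linear extension of a map defined on a basis. -/
def lin {A B : Type*} (f : A → Ser K B) : (A →₀ K) →ₗ[K] Ser K B := Finsupp.linearCombination K f

/-- The tensor product `f ⊗ g` extends to formal linear combinations: every coefficient of the
result only depends on finitely many coefficients of the argument. -/
def Extends {A B C D : Type*} (f : A → Ser K B) (g : C → Ser K D) : Prop :=
  ∀ b e, {p : A × C | f p.1 b * g p.2 e ≠ 0}.Finite

/-- The tensor product `f ⊗ g` on formal linear combinations. -/
def tensorMap {A B C D : Type*} (f : A → Ser K B) (g : C → Ser K D) (F : Ser K (A × C)) :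
    Ser K (B × D) := fun q => ∑ᶠ p : A × C, F p * (f p.1 q.1 * g p.2 q.2)

open Classical in
/-- The map `a ⊗ b ⊗ c ⊗ e ↦ a c ⊗ b ⊗ e`, where `a`, `c` are multiplied as commutative monomials
with exponents in `M →₀ ℕ`. -/
def mul13 {M B D : Type*} (F : Ser K (((M →₀ ℕ) × B) × ((M →₀ ℕ) × D))) :
    Ser K ((M →₀ ℕ) × (B × D)) := fun q =>
  ∑ p ∈ Finset.HasAntidiagonal.antidiagonal q.1, F ((p.1, q.2.1), (p.2, q.2.2))

end Coactions

end PlanarRS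

end

/-!
The Guin–Oudom recursion for the action of a product of trees has a closed form: insert all the
factors simultaneously at pairwise distinct vertices. This is visibly independent of the order of
the factors. It satisfies the recursion because inserting `σ` at a vertex of a tree obtained by
insertions either meets an untouched vertex, or is an insertion into one of the inserted trees. At
the root, insertion is `x ↦ x ∗₊ τ`, so associativity of `∗₊` yields
`τ ⋄ (x ∗₊ y) = (τ ⋄ₙᵣ x) ∗₊ y + x ∗₊ (τ ⋄ y)`: a vertex of `x ∗₊ y` is a vertex of `y` or a vertex
of `x` other than its root. By induction on the number of factors,
`m ⋄ (x ∗₊ y) = ∑ (m' ⋄ₙᵣ x) ∗₊ (m'' ⋄ y)` over the splittings of the monomial `m`, whose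
transpose is the cointeraction; the factorials coming from the pairing on the symmetric algebra
turn the sum over splittings into the product of monomials.

For finiteness, the edge labels are additive under insertion and grafting, and so is the total
vertex decoration minus the total edge decoration. A negative regularity bounds the vertex
decorations of an inserted tree by its labels and edge decorations, so only finitely many monomials
contribute to a given tree.
-/

noncomputable section

namespace PlanarRS

open Forest

section Bind

variable {K : Type*} [CommSemiring K] {A B C D W V : Type*}
  [AddCommMonoid W] [Module K W] [AddCommMonoid V] [Module K V]

/-- The linear extension of `h` evaluated at the formal linear combination `e`, i.e. the bind of
the free module monad. Identities between linear maps are stated with an arbitrary continuation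
`h`, so that they rewrite inside iterated binds. -/
def bind (e : A →₀ K) (h : A → W) : W := Finsupp.linearCombination K h e

theorem bind_eq_sum (e : A →₀ K) (h : A → W) : bind e h = e.sum fun a c => c • h a := rfl

@[simp] theorem bind_single (a : A) (c : K) (h : A → W) :
    bind (Finsupp.single a c) h = c • h a := by
  simp [bind]

theorem bind_pure (a : A) (h : A → W) : bind (Finsupp.single a (1 : K)) h = h a := by simp

@[simp] theorem bind_zero (h : A → W) : bind (0 : A →₀ K) h = 0 := by simp [bind]

theorem bind_add (e f : A →₀ K) (h : A → W) : bind (e + f) h = bind e h + bind f h := by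
  simp [bind]

theorem bind_sum {ι : Type*} (s : Finset ι) (e : ι → A →₀ K) (h : A → W) :
    bind (∑ i ∈ s, e i) h = ∑ i ∈ s, bind (e i) h := by
  simp [bind]

theorem bind_list_sum (l : List (A →₀ K)) (h : A → W) :
    bind l.sum h = (l.map fun e => bind e h).sum := by
  induction l with
  | nil => simp
  | cons e l ih => simp [bind_add, ih]

theorem bind_ite_zero (p : Prop) [Decidable p] (e : A →₀ K) (h : A → W) :
    bind (if p then e else 0) h = if p then bind e h else 0 := by
  split_ifs <;> simp

theorem map_bind (φ : W →ₗ[K] V) (e : A →₀ K) (h : A → W) :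
    φ (bind e h) = bind e fun a => φ (h a) := by
  simp only [bind_eq_sum, Finsupp.sum, map_sum, map_smul]

theorem bind_bind (e : A →₀ K) (f : A → B →₀ K) (h : B → W) :
    bind (bind e f) h = bind e fun a => bind (f a) h :=
  map_bind (Finsupp.linearCombination K h) e f

theorem bind_single_one (e : A →₀ K) : bind e (fun a => Finsupp.single a (1 : K)) = e := by
  simp [bind_eq_sum]

theorem sum_single_eq_bind (e : A →₀ K) (g : A → B) :
    (e.sum fun a c => Finsupp.single (g a) c) = bind e fun a => Finsupp.single (g a) 1 := by
  simp [bind_eq_sum]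

theorem bind_comm (e : A →₀ K) (f : B →₀ K) (h : A → B → W) :
    (bind e fun a => bind f fun b => h a b) = bind f fun b => bind e fun a => h a b := by
  simp only [bind_eq_sum, Finsupp.sum, Finset.smul_sum]
  rw [Finset.sum_comm]
  exact Finset.sum_congr rfl fun b _ => Finset.sum_congr rfl fun a _ => smul_comm _ _ _

@[simp] theorem bind_fun_zero (e : A →₀ K) : bind e (fun _ => (0 : W)) = 0 := by
  simp [bind_eq_sum]

theorem bind_fun_add (e : A →₀ K) (f h : A → W) :
    (bind e fun a => f a + h a) = bind e f + bind e h := by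
  simp [bind_eq_sum, Finsupp.sum, Finset.sum_add_distrib]

theorem bind_fun_sub {K W : Type*} [CommRing K] [AddCommGroup W] [Module K W] (e : A →₀ K)
    (f h : A → W) : (bind e fun a => f a - h a) = bind e f - bind e h := by
  simp [bind_eq_sum, Finsupp.sum, Finset.sum_sub_distrib, smul_sub]

theorem bind_fun_smul (e : A →₀ K) (c : K) (f : A → W) :
    (bind e fun a => c • f a) = c • bind e f := by
  simp [bind_eq_sum, Finsupp.sum, Finset.smul_sum, smul_comm c]

theorem bind_sum_sum_single (e : A →₀ K) (f : B →₀ K) (c : K) (g : A → B → C) (h : C → W) :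
    bind (e.sum fun a x => f.sum fun b y => Finsupp.single (g a b) (c * x * y)) h =
      c • bind e fun a => bind f fun b => h (g a b) := by
  simp only [Finsupp.sum, bind_sum, bind_single]
  simp only [bind_eq_sum, Finsupp.sum, Finset.smul_sum, smul_smul, mul_assoc]

/-- Linear extension of a function of two variables to formal linear combinations of pairs. -/
def bind₂ (e : (A × B) →₀ K) (h : A → B → W) : W := bind e fun p => h p.1 p.2

theorem bind₂_eq (e : (A × B) →₀ K) (h : A → B → W) :
    bind₂ e h = bind e fun p => h p.1 p.2 := rfl

theorem bind₂_pure (a : A) (b : B) (h : A → B → W) :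
    bind₂ (Finsupp.single (a, b) (1 : K)) h = h a b := bind_pure _ _

theorem bind₂_bind₂ (e : (C × D) →₀ K) (f : C → D → (A × B) →₀ K) (h : A → B → W) :
    bind₂ (bind₂ e f) h = bind₂ e fun c d => bind₂ (f c d) h := bind_bind _ _ _

theorem bind_bind₂ (e : (A × B) →₀ K) (f : A → B → C →₀ K) (h : C → W) :
    bind (bind₂ e f) h = bind₂ e fun a b => bind (f a b) h := bind_bind _ _ _

theorem bind_bind₂_comm (e : A →₀ K) (f : (B × C) →₀ K) (h : A → B → C → W) :
    (bind e fun a => bind₂ f fun b c => h a b c) =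
      bind₂ f fun b c => bind e fun a => h a b c := bind_comm _ _ _

theorem bind₂_comm (e : (A × D) →₀ K) (f : (B × C) →₀ K) (h : A → D → B → C → W) :
    (bind₂ e fun a d => bind₂ f fun b c => h a d b c) =
      bind₂ f fun b c => bind₂ e fun a d => h a d b c := bind_comm _ _ _

@[simp] theorem bind₂_fun_zero (e : (A × B) →₀ K) : bind₂ e (fun _ _ => (0 : W)) = 0 :=
  bind_fun_zero e

theorem bind₂_fun_add (e : (A × B) →₀ K) (f h : A → B → W) :
    (bind₂ e fun a b => f a b + h a b) = bind₂ e f + bind₂ e h := bind_fun_add _ _ _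

end Bind

attribute [irreducible] bind bind₂

section PowerSplitting

variable (K : Type*) [CommSemiring K] {d : ℕ} {W : Type*} [AddCommMonoid W] [Module K W]

/-- The binomial coproduct of `X^m`: the sum of the pairs `(l, m - l)` with multi-index binomial
coefficients. -/
def splitPow (m : Fin d → ℕ) : ((Fin d → ℕ) × (Fin d → ℕ)) →₀ K :=
  ∑ l ∈ Finset.Icc 0 m, Finsupp.single (l, m - l) (mchoose m l : K)

variable {K}

theorem bind₂_splitPow (m : Fin d → ℕ) (h : (Fin d → ℕ) → (Fin d → ℕ) → W) :
    bind₂ (splitPow K m) h = ∑ l ∈ Finset.Icc 0 m, (mchoose m l : K) • h l (m - l) := by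
  simp [splitPow, bind₂_eq, bind_sum]

theorem bind₂_splitPow_zero (h : (Fin d → ℕ) → (Fin d → ℕ) → W) :
    bind₂ (splitPow K 0) h = h 0 0 := by
  simp [bind₂_splitPow, mchoose]

theorem mchoose_eq_zero {m l : Fin d → ℕ} (h : ¬ l ≤ m) : mchoose m l = 0 := by
  obtain ⟨i, hi⟩ := not_forall.1 h
  exact Finset.prod_eq_zero (Finset.mem_univ i) (Nat.choose_eq_zero_of_lt (not_le.1 hi))

theorem pi_single_one_le_iff {l : Fin d → ℕ} {i : Fin d} : Pi.single i 1 ≤ l ↔ l i ≠ 0 := by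
  rw [← Nat.one_le_iff_ne_zero]
  refine ⟨fun h => by simpa using h i, fun h j => ?_⟩
  obtain rfl | hj := eq_or_ne j i
  · simpa using h
  · simp [hj]

theorem mchoose_add_single_of_eq_zero {m l : Fin d → ℕ} {i : Fin d} (hl : l i = 0) :
    mchoose (m + Pi.single i 1) l = mchoose m l := by
  refine Finset.prod_congr rfl fun j _ => ?_
  obtain rfl | hj := eq_or_ne j i <;> simp [*]

theorem mchoose_add_single_add_single (m l : Fin d → ℕ) (i : Fin d) :
    mchoose (m + Pi.single i 1) (l + Pi.single i 1) =
      mchoose m l + mchoose m (l + Pi.single i 1) := by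
  have off_diag (f : (Fin d → ℕ)) : ∀ j ∈ ({i} : Finset (Fin d))ᶜ,
      (f + Pi.single i 1 : Fin d → ℕ) j = f j := by
    simp +contextual
  simp only [mchoose, Fintype.prod_eq_mul_prod_compl i]
  rw [Finset.prod_congr rfl fun j hj => congrArg₂ _ (off_diag m j hj) (off_diag l j hj),
    Finset.prod_congr rfl fun j hj => congrArg (m j).choose (off_diag l j hj)]
  simp [Nat.choose_succ_succ, add_mul]

theorem mchoose_add_single (m l : Fin d → ℕ) (i : Fin d) :
    mchoose (m + Pi.single i 1) l =
      mchoose m l + if l i ≠ 0 then mchoose m (l - Pi.single i 1) else 0 := by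
  split_ifs with hl
  · obtain ⟨l, rfl⟩ := le_iff_exists_add'.1 (pi_single_one_le_iff.2 hl)
    rw [mchoose_add_single_add_single, add_tsub_cancel_right, add_comm]
  · rw [mchoose_add_single_of_eq_zero (not_not.1 hl), add_zero]

theorem bind₂_splitPow_add_single (m : Fin d → ℕ) (i : Fin d)
    (h : (Fin d → ℕ) → (Fin d → ℕ) → W) :
    bind₂ (splitPow K (m + Pi.single i 1)) h =
      bind₂ (splitPow K m) fun a b => h (a + Pi.single i 1) b + h a (b + Pi.single i 1) := by
  set e : Fin d → ℕ := Pi.single i 1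
  have shifted : ∑ l ∈ Finset.Icc 0 (m + e),
      ((if l i ≠ 0 then mchoose m (l - e) else 0 : ℕ) : K) • h l (m + e - l) =
        ∑ l ∈ Finset.Icc 0 m, (mchoose m l : K) • h (l + e) (m - l) := by
    have image : (Finset.Icc 0 (m + e)).filter (· i ≠ 0) =
        (Finset.Icc 0 m).map (addRightEmbedding e) := by
      rw [Finset.map_add_right_Icc]
      ext l
      simp [e, ← pi_single_one_le_iff, and_comm]
    simp only [Nat.cast_ite, Nat.cast_zero, ite_smul, zero_smul]
    rw [← Finset.sum_filter, image, Finset.sum_map]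
    simp [add_tsub_add_eq_tsub_right]
  have unshifted : ∑ l ∈ Finset.Icc 0 (m + e), (mchoose m l : K) • h l (m + e - l) =
      ∑ l ∈ Finset.Icc 0 m, (mchoose m l : K) • h l (m - l + e) := by
    symm
    refine Finset.sum_subset_zero_on_sdiff
      (Finset.Icc_subset_Icc le_rfl (le_add_of_nonneg_right zero_le)) (fun l hl => ?_)
      fun l hl => by rw [tsub_add_eq_add_tsub (Finset.mem_Icc.1 hl).2]
    simp only [Finset.mem_sdiff, Finset.mem_Icc, zero_le, true_and] at hl
    simp [mchoose_eq_zero hl.2]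
  simp only [bind₂_splitPow, mchoose_add_single, Nat.cast_add, add_smul, Finset.sum_add_distrib,
    smul_add, e, shifted, unshifted, add_comm]

theorem multiindex_induction {P : (Fin d → ℕ) → Prop} (zero : P 0)
    (add_single : ∀ m i, P m → P (m + Pi.single i 1)) (m : Fin d → ℕ) : P m := by
  suffices h : ∀ n, P n → P (n + m) by simpa using h 0 zero
  induction m using Pi.single_induction with
  | zero => simp
  | add f g hf hg => exact fun n hn => add_assoc n f g ▸ hg _ (hf n hn)
  | single i k =>
    induction k with
    | zero => simp
    | succ k ih =>
      intro n hn
      rw [Pi.single_add, ← add_assoc]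
      exact add_single _ i (ih n hn)

theorem splitPow_comm (m : Fin d → ℕ) (h : (Fin d → ℕ) → (Fin d → ℕ) → W) :
    bind₂ (splitPow K m) h = bind₂ (splitPow K m) fun a b => h b a := by
  induction m using multiindex_induction generalizing h with
  | zero => simp [bind₂_splitPow_zero]
  | add_single m i ih =>
    rw [bind₂_splitPow_add_single, bind₂_splitPow_add_single, ih]
    simp only [add_comm]

theorem splitPow_coassoc (m : Fin d → ℕ) (h : (Fin d → ℕ) → (Fin d → ℕ) → (Fin d → ℕ) → W) :
    (bind₂ (splitPow K m) fun p c => bind₂ (splitPow K p) fun a b => h a b c) =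
      bind₂ (splitPow K m) fun a q => bind₂ (splitPow K q) fun b c => h a b c := by
  induction m using multiindex_induction generalizing h with
  | zero => simp [bind₂_splitPow_zero]
  | add_single m i ih =>
    simp only [bind₂_splitPow_add_single, bind₂_fun_add, ih]
    abel

theorem splitPow_add (m n : Fin d → ℕ) (h : (Fin d → ℕ) → (Fin d → ℕ) → W) :
    bind₂ (splitPow K (m + n)) h =
      bind₂ (splitPow K m) fun a b => bind₂ (splitPow K n) fun a' b' => h (a + a') (b + b') := by
  induction m using multiindex_induction generalizing h with
  | zero => simp [bind₂_splitPow_zero]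
  | add_single m i ih =>
    rw [add_right_comm, bind₂_splitPow_add_single, bind₂_splitPow_add_single, ih]
    simp only [bind₂_fun_add, add_right_comm]

theorem splitPow_counit (m : Fin d → ℕ) (h : (Fin d → ℕ) → W) :
    (bind₂ (splitPow K m) fun a b => if a = 0 then h b else 0) = h m := by
  simp [bind₂_splitPow, mchoose]

open Classical in
variable (K) in
/-- The edge decoration `a` lowered by `l`, as a formal linear combination that is zero unless
`l ≤ a`. -/
def lower (a l : Fin d → ℕ) : (Fin d → ℕ) →₀ K := if l ≤ a then Finsupp.single (a - l) 1 else 0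

theorem bind_lower_add (a l k : Fin d → ℕ) (h : (Fin d → ℕ) → W) :
    bind (lower K a (l + k)) h = bind (lower K a l) fun b => bind (lower K b k) h := by
  classical
  have le_iff : l + k ≤ a ↔ l ≤ a ∧ k ≤ a - l :=
    ⟨fun H => have hl := le_self_add.trans H; ⟨hl, (le_tsub_iff_left hl).2 H⟩,
      fun H => (le_tsub_iff_left H.1).1 H.2⟩
  simp only [lower, bind_ite_zero, bind_pure, le_iff, ite_and, tsub_add_eq_tsub_tsub]

end PowerSplitting

attribute [irreducible] splitPow lower

section TreeSplitting

variable (K : Type*) [CommSemiring K] {d : ℕ} {κ ι : Type*}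
  {W : Type*} [AddCommMonoid W] [Module K W]

/-- The deshuffle coproduct as a formal linear combination of pairs. -/
def splitForest (ω : Forest d κ ι) : (Forest d κ ι × Forest d κ ι) →₀ K :=
  ((deshuffle ω).map fun p => Finsupp.single p (1 : K)).sum

/-- The coproduct of `X^m ω`, i.e. of the binomial coproduct of `X^m` and the deshuffle coproduct
of `ω`. -/
def splitTree (x : PTree d κ ι) : (PTree d κ ι × PTree d κ ι) →₀ K :=
  bind₂ (splitPow K x.1) fun a b =>
    bind₂ (splitForest K x.2) fun u v => Finsupp.single ((a, u), (b, v)) 1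

variable {K}

theorem bind₂_splitForest (ω : Forest d κ ι) (h : Forest d κ ι → Forest d κ ι → W) :
    bind₂ (splitForest K ω) h = ((deshuffle ω).map fun p => h p.1 p.2).sum := by
  simp [splitForest, bind₂_eq, bind_list_sum, Function.comp_def]

@[simp] theorem bind₂_splitForest_nil (h : Forest d κ ι → Forest d κ ι → W) :
    bind₂ (splitForest K nil) h = h nil nil := by
  simp [bind₂_splitForest, deshuffle]

theorem bind₂_splitForest_noise (ξ : ι) (a k : Fin d → ℕ) (r : Forest d κ ι)
    (h : Forest d κ ι → Forest d κ ι → W) :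
    bind₂ (splitForest K (noise ξ a k r)) h =
      bind₂ (splitForest K r) fun u v => h (noise ξ a k u) v + h u (noise ξ a k v) := by
  rw [bind₂_fun_add]
  simp [bind₂_splitForest, deshuffle, Function.comp_def]

theorem bind₂_splitForest_kernel (i : κ) (a n : Fin d → ℕ) (s r : Forest d κ ι)
    (h : Forest d κ ι → Forest d κ ι → W) :
    bind₂ (splitForest K (kernel i a n s r)) h =
      bind₂ (splitForest K r) fun u v => h (kernel i a n s u) v + h u (kernel i a n s v) := by
  rw [bind₂_fun_add]
  simp [bind₂_splitForest, deshuffle, Function.comp_def]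

theorem splitForest_comm (ω : Forest d κ ι) (h : Forest d κ ι → Forest d κ ι → W) :
    bind₂ (splitForest K ω) h = bind₂ (splitForest K ω) fun u v => h v u := by
  induction ω generalizing h with
  | nil => simp
  | noise _ _ _ _ ih | kernel _ _ _ _ _ _ ih =>
    simp only [bind₂_splitForest_noise, bind₂_splitForest_kernel]
    rw [ih]
    simp only [add_comm]

theorem splitForest_coassoc (ω : Forest d κ ι)
    (h : Forest d κ ι → Forest d κ ι → Forest d κ ι → W) :
    (bind₂ (splitForest K ω) fun p c => bind₂ (splitForest K p) fun a b => h a b c) =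
      bind₂ (splitForest K ω) fun a q => bind₂ (splitForest K q) fun b c => h a b c := by
  induction ω generalizing h with
  | nil => simp
  | noise _ _ _ _ ih | kernel _ _ _ _ _ _ ih =>
    simp only [bind₂_splitForest_noise, bind₂_splitForest_kernel, bind₂_fun_add, ih]
    abel

theorem splitForest_append (ω η : Forest d κ ι) (h : Forest d κ ι → Forest d κ ι → W) :
    bind₂ (splitForest K (ω.append η)) h =
      bind₂ (splitForest K ω) fun u v =>
        bind₂ (splitForest K η) fun u' v' => h (u.append u') (v.append v') := by
  induction ω generalizing h with
  | nil => simp [append]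
  | noise _ _ _ _ ih | kernel _ _ _ _ _ _ ih =>
    simp only [append, bind₂_splitForest_noise, bind₂_splitForest_kernel, ih, bind₂_fun_add]

open Classical in
theorem splitForest_counit (ω : Forest d κ ι) (h : Forest d κ ι → W) :
    (bind₂ (splitForest K ω) fun u v => if u = nil then h v else 0) = h ω := by
  induction ω generalizing h with
  | nil => simp
  | noise _ _ _ _ ih | kernel _ _ _ _ _ _ ih =>
    simp [bind₂_splitForest_noise, bind₂_splitForest_kernel, ih]

theorem bind₂_splitTree (x : PTree d κ ι) (h : PTree d κ ι → PTree d κ ι → W) :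
    bind₂ (splitTree K x) h =
      bind₂ (splitPow K x.1) fun a b =>
        bind₂ (splitForest K x.2) fun u v => h (a, u) (b, v) := by
  simp only [splitTree, bind₂_bind₂, bind₂_pure]

theorem splitTree_comm (x : PTree d κ ι) (h : PTree d κ ι → PTree d κ ι → W) :
    bind₂ (splitTree K x) h = bind₂ (splitTree K x) fun u v => h v u := by
  rw [bind₂_splitTree, bind₂_splitTree, splitPow_comm]
  exact congrArg _ (funext₂ fun _ _ => splitForest_comm _ _)

theorem splitTree_coassoc (x : PTree d κ ι)
    (h : PTree d κ ι → PTree d κ ι → PTree d κ ι → W) :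
    (bind₂ (splitTree K x) fun p c => bind₂ (splitTree K p) fun a b => h a b c) =
      bind₂ (splitTree K x) fun a q => bind₂ (splitTree K q) fun b c => h a b c := by
  simp only [bind₂_splitTree, bind₂_comm (splitForest K _) (splitPow K _)]
  rw [splitPow_coassoc]
  exact congrArg _ (funext₂ fun _ _ => congrArg _ (funext₂ fun _ _ => splitForest_coassoc _ _))

open Classical in
theorem splitTree_counit (x : PTree d κ ι) (h : PTree d κ ι → W) :
    (bind₂ (splitTree K x) fun y z => if y = (0, nil) then h z else 0) = h x := by
  have forest (a b : Fin d → ℕ) : (bind₂ (splitForest K x.2) fun u v =>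
      if a = 0 then if u = nil then h (b, v) else 0 else 0) =
        if a = 0 then h (b, x.2) else 0 := by
    split_ifs
    · exact splitForest_counit x.2 fun v => h (b, v)
    · simp
  simp only [bind₂_splitTree, Prod.mk.injEq, ite_and, forest]
  exact splitPow_counit x.1 fun b => h (b, x.2)

end TreeSplitting

attribute [irreducible] splitForest splitTree

theorem Forest.append_nil {d : ℕ} {κ ι : Type*} (ω : Forest d κ ι) : ω.append nil = ω := by
  induction ω with
  | nil => rfl
  | noise _ _ _ _ ih | kernel _ _ _ _ _ _ ih => simp [append, ih]

theorem Forest.append_assoc {d : ℕ} {κ ι : Type*} (ω η ζ : Forest d κ ι) :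
    (ω.append η).append ζ = ω.append (η.append ζ) := by
  induction ω with
  | nil => rfl
  | noise _ _ _ _ ih | kernel _ _ _ _ _ _ ih => simp [append, ih]

section Grafting

variable (K : Type*) [Field K] {d : ℕ} {κ ι : Type*} {W : Type*} [AddCommMonoid W] [Module K W]

/-- The part of a deformed grafting that happens at a single vertex: `X^m ω` is grafted onto a
vertex with decoration `n`. -/
def attachTree (x : PTree d κ ι) (n : Fin d → ℕ) : PTree d κ ι →₀ K :=
  bind (attach K x.2 n) fun q => Finsupp.single (q.1 + x.1, q.2) 1

/-- The deformed grafting of a tree onto the non-root vertices of a planted forest. -/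
def graft (η : Forest d κ ι) (x : PTree d κ ι) : Forest d κ ι →₀ K := graftForest K η x.1 x.2

variable {K}

theorem bind_sum_deshuffle {A B C : Type*} (x : PTree d κ ι) (e : PTree d κ ι → A →₀ K)
    (f : PTree d κ ι → B →₀ K) (g : (Fin d → ℕ) → A → B → C) (h : C → W) :
    bind (∑ m₁ ∈ Finset.Icc 0 x.1, ((deshuffle x.2).map fun p =>
        (e (m₁, p.1)).sum fun a c => (f (x.1 - m₁, p.2)).sum fun b c' =>
          Finsupp.single (g m₁ a b) ((mchoose x.1 m₁ : K) * c * c')).sum) h =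
      bind₂ (splitTree K x) fun y z => bind (e y) fun a => bind (f z) fun b => h (g y.1 a b) := by
  simp only [bind_sum, bind_list_sum, bind₂_splitTree, bind₂_splitPow, bind₂_splitForest,
    List.map_map, Function.comp_def, bind_sum_sum_single, List.smul_sum]

@[simp] theorem bind_attach_nil (n : Fin d → ℕ) (h : PTree d κ ι → W) :
    bind (attach K nil n) h = h (n, nil) := by
  simp [attach]

@[simp] theorem bind_attach_noise (ξ : ι) (a k n : Fin d → ℕ) (r : Forest d κ ι)
    (h : PTree d κ ι → W) : bind (attach K (noise ξ a k r) n) h = 0 := by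
  simp [attach]

theorem bind_attach_kernel (i : κ) (a m n : Fin d → ℕ) (s r : Forest d κ ι)
    (h : PTree d κ ι → W) :
    bind (attach K (kernel i a m s r) n) h =
      bind₂ (splitPow K n) fun l n' => bind (lower K a l) fun a' =>
        bind (attach K r n') fun p => h (p.1, kernel i a' m s p.2) := by
  classical
  have filter_le : Finset.Icc 0 (n ⊓ a) = (Finset.Icc 0 n).filter (· ≤ a) := by
    ext l; simp
  rw [attach, bind_sum, bind₂_splitPow, filter_le, Finset.sum_filter]
  refine Finset.sum_congr rfl fun l _ => ?_
  rw [lower, bind_ite_zero, bind_pure, smul_ite, smul_zero]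
  refine if_congr Iff.rfl ?_ rfl
  simp only [Finsupp.sum, bind_sum, bind_single, bind_eq_sum (attach K r (n - l)),
    Finset.smul_sum, smul_smul]

theorem bind_attachTree (x : PTree d κ ι) (n : Fin d → ℕ) (h : PTree d κ ι → W) :
    bind (attachTree K x n) h = bind (attach K x.2 n) fun q => h (q.1 + x.1, q.2) := by
  simp only [attachTree, bind_bind, bind_pure]

theorem bind_glAct (x y : PTree d κ ι) (h : PTree d κ ι → W) :
    bind (glAct K x y) h =
      bind₂ (splitTree K x) fun x₁ x₂ => bind (attachTree K x₁ y.1) fun q =>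
        bind (graft K y.2 x₂) fun u => h (q.1, q.2.append u) := by
  simp only [bind_attachTree]
  exact bind_sum_deshuffle x (fun x₁ => attach K x₁.2 y.1) (graft K y.2)
    (fun m₁ q u => (q.1 + m₁, q.2.append u)) h

open Classical in
theorem bind_graft_nil (x : PTree d κ ι) (h : Forest d κ ι → W) :
    bind (graft K nil x) h = if x = (0, nil) then h nil else 0 := by
  obtain ⟨m, ω⟩ := x
  cases ω with
  | nil => by_cases hm : m = 0 <;> simp [graft, graftForest, hm]
  | noise | kernel => simp [graft, graftForest]

theorem bind_graft_noise (ξ : ι) (a k : Fin d → ℕ) (r : Forest d κ ι) (x : PTree d κ ι)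
    (h : Forest d κ ι → W) :
    bind (graft K (noise ξ a k r) x) h = bind (graft K r x) fun u => h (noise ξ a k u) := by
  rw [graft, graftForest, sum_single_eq_bind, bind_bind]
  simp only [bind_pure, graft]

theorem bind_graft_kernel (i : κ) (a n : Fin d → ℕ) (s r : Forest d κ ι) (x : PTree d κ ι)
    (h : Forest d κ ι → W) :
    bind (graft K (kernel i a n s r) x) h =
      bind₂ (splitTree K x) fun x₁ x₂ => bind (glAct K x₁ (n, s)) fun t =>
        bind (graft K r x₂) fun u => h (kernel i a t.1 t.2 u) :=
  bind_sum_deshuffle x (fun x₁ => glAct K x₁ (n, s)) (graft K r)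
    (fun _ t u => kernel i a t.1 t.2 u) h

end Grafting

attribute [irreducible] attachTree graft

section Associativity

variable {K : Type*} [Field K] {d : ℕ} {κ ι : Type*} {W : Type*} [AddCommMonoid W] [Module K W]

theorem splitPow_left_comm (m : Fin d → ℕ)
    (h : (Fin d → ℕ) → (Fin d → ℕ) → (Fin d → ℕ) → W) :
    (bind₂ (splitPow K m) fun a q => bind₂ (splitPow K q) fun b c => h a b c) =
      bind₂ (splitPow K m) fun b q => bind₂ (splitPow K q) fun a c => h a b c := by
  rw [← splitPow_coassoc, ← splitPow_coassoc m fun b a c => h a b c]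
  exact congrArg _ (funext₂ fun _ _ => splitPow_comm _ _)

theorem splitTree_left_comm (x : PTree d κ ι)
    (h : PTree d κ ι → PTree d κ ι → PTree d κ ι → W) :
    (bind₂ (splitTree K x) fun a q => bind₂ (splitTree K q) fun b c => h a b c) =
      bind₂ (splitTree K x) fun b q => bind₂ (splitTree K q) fun a c => h a b c := by
  rw [← splitTree_coassoc, ← splitTree_coassoc x fun b a c => h a b c]
  exact congrArg _ (funext₂ fun _ _ => splitTree_comm _ _)

theorem splitTree_interchange (x : PTree d κ ι)
    (h : PTree d κ ι → PTree d κ ι → PTree d κ ι → PTree d κ ι → W) :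
    (bind₂ (splitTree K x) fun p q =>
        bind₂ (splitTree K p) fun a b => bind₂ (splitTree K q) fun c e => h a b c e) =
      bind₂ (splitTree K x) fun p q =>
        bind₂ (splitTree K p) fun a c => bind₂ (splitTree K q) fun b e => h a b c e := by
  rw [splitTree_coassoc x fun a b q => bind₂ (splitTree K q) fun c e => h a b c e,
    splitTree_coassoc x fun a c q => bind₂ (splitTree K q) fun b e => h a b c e]
  exact congrArg _ (funext₂ fun _ _ => splitTree_left_comm _ _)

theorem splitPow_attach (η : Forest d κ ι) (n : Fin d → ℕ)
    (h : (Fin d → ℕ) → (Fin d → ℕ) → Forest d κ ι → W) :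
    (bind (attach K η n) fun q => bind₂ (splitPow K q.1) fun l n' => h l n' q.2) =
      bind₂ (splitPow K n) fun l n' => bind (attach K η n') fun q => h l q.1 q.2 := by
  induction η generalizing n h with
  | nil => simp
  | noise => simp
  | kernel i a m s r _ ih =>
    simp only [bind_attach_kernel]
    simp only [fun a' p => ih p fun l n' u => h l n' (kernel i a' m s u)]
    simp only [bind_bind₂_comm _ (splitPow K _)]
    rw [splitPow_left_comm]

theorem split_attach (ω : Forest d κ ι) (n : Fin d → ℕ)
    (h : (Fin d → ℕ) → (Fin d → ℕ) → Forest d κ ι → Forest d κ ι → W) :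
    (bind (attach K ω n) fun q =>
        bind₂ (splitPow K q.1) fun a b => bind₂ (splitForest K q.2) fun u v => h a b u v) =
      bind₂ (splitPow K n) fun n₁ n₂ => bind₂ (splitForest K ω) fun ω₁ ω₂ =>
        bind (attach K ω₁ n₁) fun q₁ => bind (attach K ω₂ n₂) fun q₂ =>
          h q₁.1 q₂.1 q₁.2 q₂.2 := by
  induction ω generalizing n h with
  | nil => simp
  | noise => simp [bind₂_splitForest_noise]
  | kernel i a m s r _ ih =>
    simp only [bind_attach_kernel, bind₂_splitForest_kernel, ih, bind_bind₂_comm _ (splitPow K _),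
      bind_bind₂_comm _ (splitForest K _), bind₂_comm (splitForest K _) (splitPow K _),
      bind₂_fun_add, bind_fun_add]
    congr 1
    · rw [splitPow_coassoc]
    · rw [splitPow_left_comm]
      congr! 9
      rw [bind_comm]

theorem splitTree_attachTree (x : PTree d κ ι) (n : Fin d → ℕ)
    (h : PTree d κ ι → PTree d κ ι → W) :
    (bind (attachTree K x n) fun q => bind₂ (splitTree K q) h) =
      bind₂ (splitTree K x) fun x₁ x₂ => bind₂ (splitPow K n) fun n₁ n₂ =>
        bind (attachTree K x₁ n₁) fun q₁ => bind (attachTree K x₂ n₂) fun q₂ => h q₁ q₂ := by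
  simp only [bind_attachTree, bind₂_splitTree, splitPow_add,
    bind₂_comm (splitPow K x.1) (splitForest K _)]
  rw [split_attach x.2 n fun a b u v => bind₂ (splitPow K x.1) fun a' b' =>
    h (a + a', u) (b + b', v)]
  simp only [bind_bind₂_comm _ (splitPow K x.1), bind₂_comm _ (splitPow K x.1)]
  exact congrArg _ (funext₂ fun _ _ => bind₂_comm _ _ _)

theorem attach_attach (ω η : Forest d κ ι) (m n : Fin d → ℕ)
    (h : (Fin d → ℕ) → Forest d κ ι → W) :
    (bind (attach K ω m) fun q => bind (attach K (q.2.append η) n) fun q' =>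
        h (q'.1 + q.1) q'.2) =
      bind (attach K η n) fun q => bind (attach K ω (q.1 + m)) fun q' =>
        h q'.1 (q'.2.append q.2) := by
  induction ω generalizing m n h with
  | nil => simp [append]
  | noise => simp
  | kernel i a n' s r _ ih =>
    simp only [bind_attach_kernel, append, splitPow_add, bind_bind₂_comm _ (splitPow K n)]
    rw [splitPow_attach η n fun l₁ p u => bind₂ (splitPow K m) fun l₂ m' =>
      bind (lower K a (l₁ + l₂)) fun a' => bind (attach K r (p + m')) fun q' =>
        h q'.1 (kernel i a' n' s (q'.2.append u)), bind₂_comm]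
    congr! 3 with l₁ p
    rw [bind_bind₂_comm]
    congr! 3 with l₂ m'
    simp only [add_comm l₁ l₂, bind_lower_add, bind_comm (attach K η p) (lower K _ _),
      bind_comm (attach K r m') (lower K _ _)]
    congr! 4 with a₁ a₂
    exact ih _ _ fun b u => h b (kernel i a₂ n' s u)

theorem graft_append (ω η : Forest d κ ι) (x : PTree d κ ι) (h : Forest d κ ι → W) :
    bind (graft K (ω.append η) x) h =
      bind₂ (splitTree K x) fun x₁ x₂ =>
        bind (graft K ω x₁) fun u => bind (graft K η x₂) fun v => h (u.append v) := by
  classical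
  induction ω generalizing x h with
  | nil => simp only [bind_graft_nil, splitTree_counit, append]
  | noise ξ a k r ih => simp only [append, bind_graft_noise, ih]
  | kernel i a n s r _ ih =>
    simp only [append, bind_graft_kernel, ih, bind_bind₂_comm _ (splitTree K _)]
    rw [← splitTree_coassoc]

theorem splitForest_graft (ω : Forest d κ ι) (x : PTree d κ ι)
    (h : Forest d κ ι → Forest d κ ι → W) :
    (bind (graft K ω x) fun u => bind₂ (splitForest K u) h) =
      bind₂ (splitTree K x) fun x₁ x₂ => bind₂ (splitForest K ω) fun ω₁ ω₂ =>
        bind (graft K ω₁ x₁) fun u₁ => bind (graft K ω₂ x₂) fun u₂ => h u₁ u₂ := by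
  classical
  induction ω generalizing x h with
  | nil => simp only [bind₂_splitForest_nil, bind_graft_nil, splitTree_counit]
  | noise ξ a k r ih =>
    simp only [bind_graft_noise, bind₂_splitForest_noise, ih, bind_fun_add]
  | kernel i a n s r _ ih =>
    simp only [bind_graft_kernel, bind₂_splitForest_kernel, ih, bind_bind₂_comm _ (splitTree K _),
      bind_bind₂_comm _ (splitForest K _), bind₂_comm (splitForest K _) (splitTree K _),
      bind₂_fun_add, bind_fun_add]
    congr 1
    · rw [splitTree_coassoc]
    · rw [splitTree_left_comm]
      congr! 9
      rw [bind_comm]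

theorem graft_attach (ω : Forest d κ ι) (n : Fin d → ℕ) (x : PTree d κ ι)
    (h : (Fin d → ℕ) → Forest d κ ι → W) :
    (bind (attach K ω n) fun q => bind (graft K q.2 x) fun u => h q.1 u) =
      bind (graft K ω x) fun ω' => bind (attach K ω' n) fun q => h q.1 q.2 := by
  classical
  induction ω generalizing n x h with
  | nil => simp [bind_graft_nil]
  | noise => simp [bind_graft_noise]
  | kernel i a m s r _ ih =>
    simp only [bind_attach_kernel, bind_graft_kernel, bind_bind₂_comm _ (splitTree K _),
      bind_bind₂_comm _ (splitPow K _), bind₂_comm (splitPow K _) (splitTree K _)]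
    congr! 6 with x₁ x₂ l n'
    simp only [bind_comm _ (lower K _ _), bind_comm (attach K r n') (glAct K _ _)]
    congr! 4 with a' t
    exact ih _ _ fun b u => h b (kernel i a' t.1 t.2 u)

theorem glAct_append (n : Fin d → ℕ) (ω η : Forest d κ ι) (x : PTree d κ ι)
    (h : PTree d κ ι → W) :
    bind (glAct K x (n, ω.append η)) h =
      bind₂ (splitTree K x) fun x₁ x₂ => bind (glAct K x₁ (n, ω)) fun t =>
        bind (graft K η x₂) fun v => h (t.1, t.2.append v) := by
  simp only [bind_glAct, graft_append, append_assoc, bind_bind₂_comm _ (splitTree K _)]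
  rw [← splitTree_coassoc]

theorem attachTree_glAct (x y : PTree d κ ι) (n : Fin d → ℕ) (h : PTree d κ ι → W) :
    (bind (glAct K x y) fun w => bind (attachTree K w n) h) =
      bind (attachTree K y n) fun q => bind (glAct K x q) h := by
  simp only [bind_glAct, bind_attachTree, bind_bind₂_comm _ (splitTree K _)]
  congr! 3 with x₁ x₂
  simp only [bind_comm (attach K x₁.2 _) (graft K _ x₂), ← add_assoc]
  symm
  calc
    _ = bind (graft K y.2 x₂) fun u => bind (attach K u n) fun p =>
          bind (attach K x₁.2 (p.1 + y.1)) fun q => h (q.1 + x₁.1, q.2.append p.2) :=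
      graft_attach y.2 n x₂ fun b u => bind (attach K x₁.2 (b + y.1)) fun q =>
        h (q.1 + x₁.1, q.2.append u)
    _ = _ := congrArg _ (funext fun u =>
      (attach_attach x₁.2 u y.1 n fun b v => h (b + x₁.1, v)).symm)

theorem splitTree_append (q : PTree d κ ι) (u : Forest d κ ι)
    (h : PTree d κ ι → PTree d κ ι → W) :
    bind₂ (splitTree K (q.1, q.2.append u)) h =
      bind₂ (splitTree K q) fun q₁ q₂ => bind₂ (splitForest K u) fun u₁ u₂ =>
        h (q₁.1, q₁.2.append u₁) (q₂.1, q₂.2.append u₂) := by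
  simp only [bind₂_splitTree, splitForest_append]

theorem splitTree_glAct (x y : PTree d κ ι) (h : PTree d κ ι → PTree d κ ι → W) :
    (bind (glAct K x y) fun w => bind₂ (splitTree K w) h) =
      bind₂ (splitTree K x) fun x₁ x₂ => bind₂ (splitTree K y) fun y₁ y₂ =>
        bind (glAct K x₁ y₁) fun u => bind (glAct K x₂ y₂) fun v => h u v := by
  simp only [bind_glAct, splitTree_append, bind_bind₂_comm (graft K _ _) (splitTree K _),
    splitForest_graft, splitTree_attachTree, bind₂_splitTree y]
  simp only [bind_bind₂_comm _ (splitTree K _), bind₂_comm (splitForest K _) (splitTree K _),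
    bind₂_comm (splitPow K _) (splitTree K _), bind_bind₂_comm _ (splitForest K _)]
  rw [splitTree_interchange x fun a b c e => bind₂ (splitPow K y.1) fun n₁ n₂ =>
    bind₂ (splitForest K y.2) fun s₁ s₂ => bind (attachTree K a n₁) fun q₁ =>
    bind (attachTree K b n₂) fun q₂ => bind (graft K s₁ c) fun u₁ =>
    bind (graft K s₂ e) fun u₂ => h (q₁.1, q₁.2.append u₁) (q₂.1, q₂.2.append u₂)]
  simp only [bind_comm (attachTree K _ _) (graft K _ _)]

open Classical in
theorem glAct_counit (x y : PTree d κ ι) (c : W) :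
    (bind (glAct K x y) fun w => if w = (0, nil) then c else 0) =
      if x = (0, nil) ∧ y = (0, nil) then c else 0 := by
  rw [bind_glAct]
  obtain ⟨m, η⟩ := y
  cases η with
  | nil =>
    simp only [bind_comm (attachTree K _ _) (graft K _ _)]
    rw [splitTree_comm]
    simp only [bind_graft_nil, splitTree_counit]
    obtain ⟨n, ω⟩ := x
    cases ω <;> simp [bind_attachTree, append_nil, bind_attach_kernel, and_comm]
  | noise ξ a k r =>
    have append_ne (u v : Forest d κ ι) : u.append (noise ξ a k v) ≠ nil := by
      cases u <;> simp [append]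
    simp [bind_graft_noise, append_ne]
  | kernel i a k s r =>
    have append_ne (u v w : Forest d κ ι) (k) : u.append (kernel i a k v w) ≠ nil := by
      cases u <;> simp [append]
    simp [bind_graft_kernel, append_ne]

theorem glAct_assoc_of_graft_graft (z x y : PTree d κ ι)
    (graft_graft : ∀ (x y : PTree d κ ι) (h : Forest d κ ι → W),
      (bind (graft K z.2 y) fun w => bind (graft K w x) h) =
        bind (glAct K x y) fun w => bind (graft K z.2 w) h) (h : PTree d κ ι → W) :
    (bind (glAct K y z) fun w => bind (glAct K x w) h) =
      bind (glAct K x y) fun w => bind (glAct K w z) h := by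
  simp only [bind_glAct _ z, splitTree_glAct, glAct_append, bind_bind₂_comm _ (splitTree K _)]
  rw [bind₂_comm]
  congr! 6 with x₁ x₂ y₁ y₂
  simp only [bind_comm (graft K z.2 y₂) (glAct K x₁ _), graft_graft]
  rw [← attachTree_glAct]
  congr! 2 with w
  rw [bind_comm]

theorem graft_graft (η : Forest d κ ι) (x y : PTree d κ ι) (h : Forest d κ ι → W) :
    (bind (graft K η y) fun w => bind (graft K w x) h) =
      bind (glAct K x y) fun w => bind (graft K η w) h := by
  classical
  induction η generalizing x y h with
  | nil =>
    simp only [bind_graft_nil, glAct_counit]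
    split_ifs <;> simp_all
  | noise ξ a k r ih => simp only [bind_graft_noise, ih]
  | kernel i a n s r ihs ihr =>
    simp only [bind_graft_kernel, splitTree_glAct, bind_bind₂_comm _ (splitTree K _)]
    rw [bind₂_comm]
    congr! 6 with x₁ x₂ y₁ y₂
    simp only [bind_comm (graft K r y₂) (glAct K x₁ _), ihr,
      glAct_assoc_of_graft_graft (n, s) x₁ y₁ fun x y _ => ihs x y _]
    congr! 2 with w
    rw [bind_comm]

theorem glAct_assoc (x y z : PTree d κ ι) (h : PTree d κ ι → W) :
    (bind (glAct K y z) fun w => bind (glAct K x w) h) =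
      bind (glAct K x y) fun w => bind (glAct K w z) h :=
  glAct_assoc_of_graft_graft z x y (graft_graft z.2) h

end Associativity

section RootNoise

variable {K : Type*} [Field K] {d : ℕ} {κ ι : Type*} {W : Type*} [AddCommMonoid W] [Module K W]

theorem rootNoise_add_of_mem_deshuffle {ω : Forest d κ ι} {p : Forest d κ ι × Forest d κ ι}
    (hp : p ∈ deshuffle ω) : p.1.rootNoise + p.2.rootNoise = ω.rootNoise := by
  induction ω generalizing p with
  | nil => simp_all [deshuffle, rootNoise]
  | noise _ _ _ _ ih | kernel _ _ _ _ _ _ ih =>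
    simp only [deshuffle, List.mem_append, List.mem_map] at hp
    rcases hp with ⟨q, hq, rfl⟩ | ⟨q, hq, rfl⟩ <;>
    · have := ih hq
      simp only [rootNoise]
      lia

theorem bind₂_splitTree_eq_zero {x : PTree d κ ι} (hx : x.2.rootNoise ≠ 0)
    {h : PTree d κ ι → PTree d κ ι → W} (left : ∀ u v, u.2.rootNoise ≠ 0 → h u v = 0)
    (right : ∀ u v, v.2.rootNoise ≠ 0 → h u v = 0) : bind₂ (splitTree K x) h = 0 := by
  rw [bind₂_splitTree]
  convert bind₂_fun_zero _ with a b
  rw [bind₂_splitForest, List.sum_eq_zero]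
  simp only [List.mem_map, forall_exists_index, and_imp]
  rintro _ p hp rfl
  have additive := rootNoise_add_of_mem_deshuffle hp
  by_cases hu : p.1.rootNoise = 0
  · exact right _ _ (by simp only; lia)
  · exact left _ _ hu

theorem attach_eq_zero {ω : Forest d κ ι} (hω : ω.rootNoise ≠ 0) (n : Fin d → ℕ) :
    attach K ω n = 0 := by
  induction ω generalizing n with
  | nil => simp [rootNoise] at hω
  | noise => simp [attach]
  | kernel i a m s r _ ih => simp [attach, ih hω]

theorem bind_glAct_eq_zero_of_graft {x y : PTree d κ ι} (hx : x.2.rootNoise ≠ 0)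
    (graft_eq_zero : ∀ {x : PTree d κ ι} (_ : x.2.rootNoise ≠ 0) (h : Forest d κ ι → W),
      bind (graft K y.2 x) h = 0) (h : PTree d κ ι → W) : bind (glAct K x y) h = 0 := by
  rw [bind_glAct]
  refine bind₂_splitTree_eq_zero hx (fun u v hu => ?_) fun u v hv => ?_
  · rw [bind_attachTree, attach_eq_zero hu, bind_zero]
  · simp only [graft_eq_zero hv, bind_fun_zero]

theorem bind_graft_eq_zero (η : Forest d κ ι) {x : PTree d κ ι} (hx : x.2.rootNoise ≠ 0)
    (h : Forest d κ ι → W) : bind (graft K η x) h = 0 := by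
  classical
  induction η generalizing x h with
  | nil =>
    rw [bind_graft_nil, if_neg]
    rintro rfl
    simp [rootNoise] at hx
  | noise ξ a k r ih => rw [bind_graft_noise, ih hx]
  | kernel i a m s r ihs ihr =>
    rw [bind_graft_kernel]
    refine bind₂_splitTree_eq_zero hx (fun u v hu => ?_) fun u v hv => ?_
    · exact bind_glAct_eq_zero_of_graft hu (fun hx _ => ihs hx _) _
    · simp only [ihr hv, bind_fun_zero]

theorem glAct_eq_zero {x : PTree d κ ι} (hx : x.2.rootNoise ≠ 0) (y : PTree d κ ι) :
    glAct K x y = 0 := by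
  rw [← bind_single_one (glAct K x y), bind_glAct_eq_zero_of_graft hx (bind_graft_eq_zero y.2)]

end RootNoise

section Insertion

variable {K : Type*} [Field K] {d : ℕ} {κ ι : Type*} {W : Type*} [AddCommMonoid W] [Module K W]

theorem insertion_eq_glAct_add (τ x : PTree d κ ι) :
    insertion K τ x = glAct K x τ + insertionNonRoot K τ x := by
  rw [insertion, insertRoot, insertionNonRoot]
  split_ifs with hx
  · rfl
  · rw [glAct_eq_zero hx]

theorem bind_insertionNonRoot (τ x : PTree d κ ι) (h : PTree d κ ι → W) :
    bind (insertionNonRoot K τ x) h = bind (insertForest K τ x.2) fun u => h (x.1, u) := by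
  simp only [insertionNonRoot, sum_single_eq_bind, bind_bind, bind_pure]

theorem bind_insertForest_nil (τ : PTree d κ ι) (h : Forest d κ ι → W) :
    bind (insertForest K τ nil) h = 0 := by
  rw [insertForest, bind_zero]

theorem bind_insertForest_noise (τ : PTree d κ ι) (ξ : ι) (a k : Fin d → ℕ) (r : Forest d κ ι)
    (h : Forest d κ ι → W) :
    bind (insertForest K τ (noise ξ a k r)) h =
      bind (insertForest K τ r) fun u => h (noise ξ a k u) := by
  simp only [insertForest, sum_single_eq_bind, bind_bind, bind_pure]

theorem bind_insertForest_kernel (τ : PTree d κ ι) (i : κ) (a n : Fin d → ℕ) (s r : Forest d κ ι)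
    (h : Forest d κ ι → W) :
    bind (insertForest K τ (kernel i a n s r)) h =
      (bind (insertion K τ (n, s)) fun t => h (kernel i a t.1 t.2 r)) +
        bind (insertForest K τ r) fun u => h (kernel i a n s u) := by
  simp only [insertForest, bind_add, sum_single_eq_bind _ fun u => kernel i a n s u,
    sum_single_eq_bind _ fun t : PTree d κ ι => kernel i a t.1 t.2 r, bind_bind, bind_pure,
    insertion]

theorem insertForest_append (τ : PTree d κ ι) (ω η : Forest d κ ι) (h : Forest d κ ι → W) :
    bind (insertForest K τ (ω.append η)) h =
      (bind (insertForest K τ ω) fun u => h (u.append η)) +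
        bind (insertForest K τ η) fun v => h (ω.append v) := by
  induction ω generalizing h with
  | nil => simp [append, bind_insertForest_nil]
  | noise ξ a k r ih => simp only [append, bind_insertForest_noise, ih]
  | kernel i a n s r _ ih => simp only [append, bind_insertForest_kernel, ih, add_assoc]

theorem splitForest_insertForest (τ : PTree d κ ι) (ω : Forest d κ ι)
    (h : Forest d κ ι → Forest d κ ι → W) :
    (bind (insertForest K τ ω) fun u => bind₂ (splitForest K u) h) =
      bind₂ (splitForest K ω) fun u v => (bind (insertForest K τ u) fun u' => h u' v) +
        bind (insertForest K τ v) fun v' => h u v' := by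
  induction ω generalizing h with
  | nil => simp [bind_insertForest_nil]
  | noise ξ a k r ih =>
    simp only [bind_insertForest_noise, bind₂_splitForest_noise, ih, bind_fun_add, bind₂_fun_add]
    abel
  | kernel i a n s r _ ih =>
    simp only [bind_insertForest_kernel, bind₂_splitForest_kernel, ih, bind_fun_add,
      bind₂_fun_add, bind_bind₂_comm]
    abel

theorem splitTree_insertionNonRoot (τ x : PTree d κ ι) (h : PTree d κ ι → PTree d κ ι → W) :
    (bind (insertionNonRoot K τ x) fun w => bind₂ (splitTree K w) h) =
      bind₂ (splitTree K x) fun u v => (bind (insertionNonRoot K τ u) fun u' => h u' v) +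
        bind (insertionNonRoot K τ v) fun v' => h u v' := by
  simp only [bind_insertionNonRoot, bind₂_splitTree, bind_bind₂_comm _ (splitPow K _),
    splitForest_insertForest]

theorem insertForest_attach (τ : PTree d κ ι) (ω : Forest d κ ι) (n : Fin d → ℕ)
    (h : (Fin d → ℕ) → Forest d κ ι → W) :
    (bind (attach K ω n) fun q => bind (insertForest K τ q.2) fun u => h q.1 u) =
      bind (insertForest K τ ω) fun u => bind (attach K u n) fun q => h q.1 q.2 := by
  induction ω generalizing n h with
  | nil => simp [bind_insertForest_nil]
  | noise => simp [bind_insertForest_noise]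
  | kernel i a m s r _ ih =>
    simp only [bind_attach_kernel, bind_insertForest_kernel, bind_fun_add, bind₂_fun_add,
      bind_bind₂_comm _ (splitPow K _), fun a' p => ih p fun b u => h b (kernel i a' m s u)]
    simp only [bind_comm (insertion K _ _) (lower K _ _),
      bind_comm (insertForest K _ _) (lower K _ _), bind_comm (insertion K _ _) (attach K _ _)]

theorem insertionNonRoot_attachTree (τ x : PTree d κ ι) (n : Fin d → ℕ) (h : PTree d κ ι → W) :
    (bind (attachTree K x n) fun q => bind (insertionNonRoot K τ q) h) =
      bind (insertionNonRoot K τ x) fun w => bind (attachTree K w n) h := by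
  simp only [bind_attachTree, bind_insertionNonRoot]
  exact insertForest_attach τ x.2 n fun b u => h (b + x.1, u)

theorem insertionNonRoot_append (τ q : PTree d κ ι) (u : Forest d κ ι) (h : PTree d κ ι → W) :
    bind (insertionNonRoot K τ (q.1, q.2.append u)) h =
      (bind (insertionNonRoot K τ q) fun q' => h (q'.1, q'.2.append u)) +
        bind (insertForest K τ u) fun v => h (q.1, q.2.append v) := by
  simp only [bind_insertionNonRoot, insertForest_append]

theorem insertion_glAct_of_insertForest_graft (τ x y : PTree d κ ι)
    (insertForest_graft : ∀ (x : PTree d κ ι) (h : Forest d κ ι → W),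
      (bind (graft K y.2 x) fun w => bind (insertForest K τ w) h) =
        (bind (insertionNonRoot K τ x) fun x' => bind (graft K y.2 x') h) +
          bind (insertForest K τ y.2) fun s' => bind (graft K s' x) h) (h : PTree d κ ι → W) :
    (bind (glAct K x y) fun w => bind (insertion K τ w) h) =
      (bind (insertionNonRoot K τ x) fun x' => bind (glAct K x' y) h) +
        bind (insertion K τ y) fun y' => bind (glAct K x y') h := by
  simp only [insertion_eq_glAct_add, bind_add, bind_fun_add]
  rw [← glAct_assoc, add_left_comm]
  congr 1
  simp only [bind_glAct _ y, splitTree_insertionNonRoot, bind_insertionNonRoot τ y]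
  simp only [bind_glAct, insertionNonRoot_append, bind_fun_add, bind₂_fun_add, insertForest_graft,
    add_assoc, bind_bind₂_comm _ (splitTree K _), bind_comm (graft K _ _) (insertionNonRoot K _ _),
    bind_comm (insertForest K _ _) (attachTree K _ _), insertionNonRoot_attachTree,
    bind_comm (insertionNonRoot K _ _) (attachTree K _ _)]

theorem insertForest_graft (τ : PTree d κ ι) (η : Forest d κ ι) (x : PTree d κ ι)
    (h : Forest d κ ι → W) :
    (bind (graft K η x) fun w => bind (insertForest K τ w) h) =
      (bind (insertionNonRoot K τ x) fun x' => bind (graft K η x') h) +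
        bind (insertForest K τ η) fun η' => bind (graft K η' x) h := by
  classical
  induction η generalizing x h with
  | nil =>
    obtain ⟨m, ω⟩ := x
    cases ω <;> simp [bind_graft_nil, bind_insertionNonRoot, bind_insertForest_nil,
      bind_insertForest_noise, bind_insertForest_kernel]
  | noise ξ a k r ih => simp only [bind_graft_noise, bind_insertForest_noise, ih]
  | kernel i a n s r ihs ihr =>
    simp only [bind_graft_kernel, bind_insertForest_kernel, splitTree_insertionNonRoot,
      bind_fun_add, bind₂_fun_add, ihr, bind_comm (graft K r _) (insertion K τ _),
      insertion_glAct_of_insertForest_graft τ _ (n, s) fun x _ => ihs x _,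
      bind_bind₂_comm _ (splitTree K _), add_assoc,
      bind_comm (glAct K _ (n, s)) (insertionNonRoot K τ _),
      bind_comm (glAct K _ (n, s)) (insertForest K τ _)]
    abel

theorem insertion_glAct (τ x y : PTree d κ ι) (h : PTree d κ ι → W) :
    (bind (glAct K x y) fun w => bind (insertion K τ w) h) =
      (bind (insertionNonRoot K τ x) fun x' => bind (glAct K x' y) h) +
        bind (insertion K τ y) fun y' => bind (glAct K x y') h :=
  insertion_glAct_of_insertForest_graft τ x y (insertForest_graft τ y.2) h

end Insertion

section Monomials

variable (K : Type*) [CommSemiring K] {A : Type*} {W : Type*} [AddCommMonoid W] [Module K W]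

/-- The coproduct `∑ u ⊗ v` of the monomial `m` over all ways to distribute its factors into two
monomials with `u v = m`. -/
def splitMon (m : Multiset A) : (Multiset A × Multiset A) →₀ K :=
  (m.antidiagonal.map fun p => Finsupp.single p (1 : K)).sum

open Classical in
/-- The sum `∑ u ⊗ a` over all ways to single out one factor `a` of the monomial `m = u a`. -/
def pickMon (m : Multiset A) : (Multiset A × A) →₀ K :=
  (m.map fun a => Finsupp.single (m.erase a, a) (1 : K)).sum

variable {K}

theorem bind_multiset_sum {B : Type*} (l : Multiset (B →₀ K)) (h : B → W) :
    bind l.sum h = (l.map fun e => bind e h).sum := by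
  induction l using Multiset.induction with
  | empty => simp
  | cons a l ih => simp [bind_add, ih]

theorem bind₂_splitMon (m : Multiset A) (h : Multiset A → Multiset A → W) :
    bind₂ (splitMon K m) h = (m.antidiagonal.map fun p => h p.1 p.2).sum := by
  simp [splitMon, bind₂_eq, bind_multiset_sum]

open Classical in
theorem bind₂_pickMon (m : Multiset A) (h : Multiset A → A → W) :
    bind₂ (pickMon K m) h = (m.map fun a => h (m.erase a) a).sum := by
  simp [pickMon, bind₂_eq, bind_multiset_sum]

@[simp] theorem bind₂_splitMon_zero (h : Multiset A → Multiset A → W) :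
    bind₂ (splitMon K 0) h = h 0 0 := by
  simp [bind₂_splitMon]

theorem bind₂_splitMon_cons (a : A) (m : Multiset A) (h : Multiset A → Multiset A → W) :
    bind₂ (splitMon K (a ::ₘ m)) h =
      bind₂ (splitMon K m) fun u v => h (a ::ₘ u) v + h u (a ::ₘ v) := by
  rw [bind₂_fun_add]
  simp [bind₂_splitMon, add_comm]

@[simp] theorem bind₂_pickMon_zero (h : Multiset A → A → W) :
    bind₂ (pickMon K 0) h = 0 := by
  simp [bind₂_pickMon]

theorem bind₂_pickMon_cons (a : A) (m : Multiset A) (h : Multiset A → A → W) :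
    bind₂ (pickMon K (a ::ₘ m)) h =
      h m a + bind₂ (pickMon K m) fun u b => h (a ::ₘ u) b := by
  classical
  simp only [bind₂_pickMon, Multiset.map_cons, Multiset.sum_cons, Multiset.erase_cons_head]
  congr 2
  exact Multiset.map_congr rfl fun b hb => by rw [Multiset.erase_cons_tail_of_mem hb]

theorem bind₂_pickMon_congr {m : Multiset A} {f h : Multiset A → A → W}
    (eq : ∀ u a, a ::ₘ u = m → f u a = h u a) :
    bind₂ (pickMon K m) f = bind₂ (pickMon K m) h := by
  classical
  rw [bind₂_pickMon, bind₂_pickMon]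
  congr 1
  exact Multiset.map_congr rfl fun a ha => eq _ _ (Multiset.cons_erase ha)

end Monomials

section MonomialInsertion

variable (K : Type*) [Field K] {d : ℕ} {κ ι : Type*} {W : Type*} [AddCommMonoid W] [Module K W]

/-- Insertion of `τ` into the factors of a monomial of trees, as a derivation. -/
def insertMon (τ : PTree d κ ι) (m : Multiset (PTree d κ ι)) : Multiset (PTree d κ ι) →₀ K :=
  bind₂ (pickMon K m) fun u σ => bind (insertion K τ σ) fun ρ => Finsupp.single (ρ ::ₘ u) 1

variable {K}

theorem bind_insertMon (τ : PTree d κ ι) (m : Multiset (PTree d κ ι))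
    (h : Multiset (PTree d κ ι) → W) :
    bind (insertMon K τ m) h =
      bind₂ (pickMon K m) fun u σ => bind (insertion K τ σ) fun ρ => h (ρ ::ₘ u) := by
  simp only [insertMon, bind_bind₂, bind_bind, bind_pure]

@[simp] theorem bind_insertMon_zero (τ : PTree d κ ι) (h : Multiset (PTree d κ ι) → W) :
    bind (insertMon K τ 0) h = 0 := by
  rw [bind_insertMon, bind₂_pickMon_zero]

theorem bind_insertMon_cons (τ σ : PTree d κ ι) (m : Multiset (PTree d κ ι))
    (h : Multiset (PTree d κ ι) → W) :
    bind (insertMon K τ (σ ::ₘ m)) h =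
      (bind (insertion K τ σ) fun ρ => h (ρ ::ₘ m)) +
        bind (insertMon K τ m) fun u => h (σ ::ₘ u) := by
  simp only [bind_insertMon, bind₂_pickMon_cons, Multiset.cons_swap σ]

theorem bind_insertMon_congr {τ : PTree d κ ι} {m : Multiset (PTree d κ ι)}
    {f h : Multiset (PTree d κ ι) → W} (eq : ∀ u, u.card = m.card → f u = h u) :
    bind (insertMon K τ m) f = bind (insertMon K τ m) h := by
  rw [bind_insertMon, bind_insertMon]
  refine bind₂_pickMon_congr fun u a hu => ?_
  congr! 2 with ρ
  exact eq _ (by simp [← hu])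

theorem splitMon_insertMon (τ : PTree d κ ι) (m : Multiset (PTree d κ ι))
    (h : Multiset (PTree d κ ι) → Multiset (PTree d κ ι) → W) :
    (bind (insertMon K τ m) fun u => bind₂ (splitMon K u) h) =
      bind₂ (splitMon K m) fun u v => (bind (insertMon K τ u) fun u' => h u' v) +
        bind (insertMon K τ v) fun v' => h u v' := by
  induction m using Multiset.induction generalizing h with
  | empty => simp
  | cons σ m ih =>
    simp only [bind_insertMon_cons, bind₂_splitMon_cons, ih, bind_fun_add, bind₂_fun_add,
      bind_bind₂_comm]
    abel

theorem pickMon_insertMon (τ : PTree d κ ι) (m : Multiset (PTree d κ ι))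
    (h : Multiset (PTree d κ ι) → PTree d κ ι → W) :
    (bind (insertMon K τ m) fun u => bind₂ (pickMon K u) h) =
      bind₂ (pickMon K m) fun u σ => (bind (insertMon K τ u) fun u' => h u' σ) +
        bind (insertion K τ σ) fun ρ => h u ρ := by
  induction m using Multiset.induction generalizing h with
  | empty => simp
  | cons σ m ih =>
    simp only [bind_insertMon_cons, bind₂_pickMon_cons, ih, bind_fun_add, bind₂_fun_add,
      bind_bind₂_comm]
    abel

attribute [irreducible] splitMon pickMon insertMon

end MonomialInsertion

section SimultaneousInsertion

variable (K : Type*) [Field K] {d : ℕ} {κ ι : Type*} {W : Type*} [AddCommMonoid W] [Module K W]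

/-- Insertion of the factors of a monomial of trees into pairwise distinct vertices of a tree with
root decoration `n`, given the insertion `F` into the non-root vertices. At most one factor `σ` is
inserted into the root; as that is grafting onto `σ`, it vanishes next to a noise edge. -/
def insertAllRoot (n : Fin d → ℕ) (F : Multiset (PTree d κ ι) → (Forest d κ ι →₀ K))
    (m : Multiset (PTree d κ ι)) : PTree d κ ι →₀ K :=
  (bind (F m) fun u => Finsupp.single (n, u) 1) +
    bind₂ (pickMon K m) fun v σ => bind (F v) fun u => glAct K (n, u) σ

open Classical in
/-- Insertion of the factors of a monomial of trees into pairwise distinct non-root vertices of a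
planted forest. -/
def insertAllForest : Forest d κ ι → Multiset (PTree d κ ι) → (Forest d κ ι →₀ K)
  | nil, m => if m = 0 then Finsupp.single nil 1 else 0
  | noise ξ a k r, m => bind (insertAllForest r m) fun u => Finsupp.single (noise ξ a k u) 1
  | kernel i a n s r, m =>
      bind₂ (splitMon K m) fun v w => bind (insertAllRoot K n (insertAllForest s) v) fun t =>
        bind (insertAllForest r w) fun u => Finsupp.single (kernel i a t.1 t.2 u) 1

/-- Insertion of the factors of a monomial of trees into pairwise distinct vertices of a tree: the
closed form of the Guin–Oudom extension of `insertion`. -/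
def insertAll (t : PTree d κ ι) (m : Multiset (PTree d κ ι)) : PTree d κ ι →₀ K :=
  insertAllRoot K t.1 (insertAllForest K t.2) m

/-- Insertion of the factors of a monomial of trees into pairwise distinct non-root vertices of a
tree: the closed form of the Guin–Oudom extension of `insertionNonRoot`. -/
def insertAllNonRoot (t : PTree d κ ι) (m : Multiset (PTree d κ ι)) : PTree d κ ι →₀ K :=
  bind (insertAllForest K t.2 m) fun u => Finsupp.single (t.1, u) 1

variable {K}

theorem bind_insertAll (t : PTree d κ ι) (m : Multiset (PTree d κ ι)) (h : PTree d κ ι → W) :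
    bind (insertAll K t m) h = (bind (insertAllForest K t.2 m) fun u => h (t.1, u)) +
      bind₂ (pickMon K m) fun v σ => bind (insertAllForest K t.2 v) fun u =>
        bind (glAct K (t.1, u) σ) h := by
  simp only [insertAll, insertAllRoot, bind_add, bind_bind, bind_bind₂, bind_pure]

theorem bind_insertAllNonRoot (t : PTree d κ ι) (m : Multiset (PTree d κ ι))
    (h : PTree d κ ι → W) :
    bind (insertAllNonRoot K t m) h = bind (insertAllForest K t.2 m) fun u => h (t.1, u) := by
  simp only [insertAllNonRoot, bind_bind, bind_pure]

open Classical in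
theorem bind_insertAllForest_nil (m : Multiset (PTree d κ ι)) (h : Forest d κ ι → W) :
    bind (insertAllForest K nil m) h = if m = 0 then h nil else 0 := by
  rw [insertAllForest, bind_ite_zero, bind_pure]

theorem bind_insertAllForest_noise (ξ : ι) (a k : Fin d → ℕ) (r : Forest d κ ι)
    (m : Multiset (PTree d κ ι)) (h : Forest d κ ι → W) :
    bind (insertAllForest K (noise ξ a k r) m) h =
      bind (insertAllForest K r m) fun u => h (noise ξ a k u) := by
  simp only [insertAllForest, bind_bind, bind_pure]

theorem bind_insertAllForest_kernel (i : κ) (a n : Fin d → ℕ) (s r : Forest d κ ι)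
    (m : Multiset (PTree d κ ι)) (h : Forest d κ ι → W) :
    bind (insertAllForest K (kernel i a n s r) m) h =
      bind₂ (splitMon K m) fun v w => bind (insertAll K (n, s) v) fun t =>
        bind (insertAllForest K r w) fun u => h (kernel i a t.1 t.2 u) := by
  simp only [insertAllForest, bind_bind, bind_bind₂, bind_pure, insertAll]

theorem insertAllForest_zero (η : Forest d κ ι) (h : Forest d κ ι → W) :
    bind (insertAllForest K η 0) h = h η := by
  induction η generalizing h with
  | nil => simp [bind_insertAllForest_nil]
  | noise ξ a k r ih => rw [bind_insertAllForest_noise, ih]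
  | kernel i a n s r ihs ihr => simp [bind_insertAllForest_kernel, bind_insertAll, ihs, ihr]

@[simp] theorem insertAll_zero (t : PTree d κ ι) : insertAll K t 0 = Finsupp.single t 1 := by
  rw [← bind_single_one (insertAll K t 0)]
  simp [bind_insertAll, insertAllForest_zero]

@[simp] theorem insertAllNonRoot_zero (t : PTree d κ ι) :
    insertAllNonRoot K t 0 = Finsupp.single t 1 := by
  simp [insertAllNonRoot, insertAllForest_zero]

theorem insertion_insertAll_of_insertForest (τ t : PTree d κ ι)
    (insertForest_insertAllForest : ∀ (m : Multiset (PTree d κ ι)) (h : Forest d κ ι → W),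
      (bind (insertAllForest K t.2 m) fun u => bind (insertForest K τ u) h) =
        bind (insertAllForest K t.2 (τ ::ₘ m)) h +
          bind (insertMon K τ m) fun m' => bind (insertAllForest K t.2 m') h)
    (m : Multiset (PTree d κ ι)) (h : PTree d κ ι → W) :
    (bind (insertAll K t m) fun u => bind (insertion K τ u) h) =
      bind (insertAll K t (τ ::ₘ m)) h +
        bind (insertMon K τ m) fun m' => bind (insertAll K t m') h := by
  simp only [bind_insertAll, insertion_glAct, bind_insertionNonRoot, bind_fun_add,
    bind₂_fun_add, bind₂_pickMon_cons, pickMon_insertMon]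
  simp only [insertion_eq_glAct_add, bind_add, bind_fun_add, bind₂_fun_add, bind_insertionNonRoot,
    insertForest_insertAllForest, bind_comm (glAct K _ _) (insertAllForest K _ _),
    bind_comm (insertForest K _ _) (insertAllForest K _ _)]
  abel

theorem insertForest_insertAllForest (τ : PTree d κ ι) (η : Forest d κ ι)
    (m : Multiset (PTree d κ ι)) (h : Forest d κ ι → W) :
    (bind (insertAllForest K η m) fun u => bind (insertForest K τ u) h) =
      bind (insertAllForest K η (τ ::ₘ m)) h +
        bind (insertMon K τ m) fun m' => bind (insertAllForest K η m') h := by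
  induction η generalizing m h with
  | nil =>
    classical
    simp [bind_insertAllForest_nil, bind_insertForest_nil, bind_insertMon]
  | noise ξ a k r ih => simp only [bind_insertAllForest_noise, bind_insertForest_noise, ih]
  | kernel i a n s r ihs ihr =>
    simp only [bind_insertAllForest_kernel, bind_insertForest_kernel, bind₂_splitMon_cons,
      splitMon_insertMon, bind_fun_add, bind₂_fun_add, ihr,
      bind_comm (insertAllForest K r _) (insertion K _ _),
      bind_comm (insertAll K _ _) (insertMon K _ _),
      insertion_insertAll_of_insertForest τ (n, s) ihs]
    abel

theorem insertion_insertAll (τ t : PTree d κ ι) (m : Multiset (PTree d κ ι))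
    (h : PTree d κ ι → W) :
    (bind (insertAll K t m) fun u => bind (insertion K τ u) h) =
      bind (insertAll K t (τ ::ₘ m)) h +
        bind (insertMon K τ m) fun m' => bind (insertAll K t m') h :=
  insertion_insertAll_of_insertForest τ t (insertForest_insertAllForest τ t.2) m h

theorem insertionNonRoot_insertAllNonRoot (τ t : PTree d κ ι) (m : Multiset (PTree d κ ι))
    (h : PTree d κ ι → W) :
    (bind (insertAllNonRoot K t m) fun u => bind (insertionNonRoot K τ u) h) =
      bind (insertAllNonRoot K t (τ ::ₘ m)) h +
        bind (insertMon K τ m) fun m' => bind (insertAllNonRoot K t m') h := by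
  simp only [bind_insertAllNonRoot, bind_insertionNonRoot]
  exact insertForest_insertAllForest τ t.2 m _

end SimultaneousInsertion

section Cointeraction

variable {K : Type*} [Field K] {d : ℕ} {κ ι : Type*} {W : Type*} [AddCommGroup W] [Module K W]

theorem insertAll_cons (τ t : PTree d κ ι) (m : Multiset (PTree d κ ι)) (h : PTree d κ ι → W) :
    bind (insertAll K t (τ ::ₘ m)) h =
      (bind (insertAll K t m) fun u => bind (insertion K τ u) h) -
        bind (insertMon K τ m) fun m' => bind (insertAll K t m') h :=
  eq_sub_of_add_eq (insertion_insertAll τ t m h).symm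

theorem insertAllNonRoot_cons (τ t : PTree d κ ι) (m : Multiset (PTree d κ ι))
    (h : PTree d κ ι → W) :
    bind (insertAllNonRoot K t (τ ::ₘ m)) h =
      (bind (insertAllNonRoot K t m) fun u => bind (insertionNonRoot K τ u) h) -
        bind (insertMon K τ m) fun m' => bind (insertAllNonRoot K t m') h :=
  eq_sub_of_add_eq (insertionNonRoot_insertAllNonRoot τ t m h).symm

/-- The cointeraction in dual form; the induction on the length of `m` propagates `insertion_glAct`
through the Guin–Oudom recursion. -/
theorem insertAll_glAct (x y : PTree d κ ι) (m : Multiset (PTree d κ ι)) (h : PTree d κ ι → W) :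
    (bind (glAct K x y) fun w => bind (insertAll K w m) h) =
      bind₂ (splitMon K m) fun u v => bind (insertAllNonRoot K x u) fun x' =>
        bind (insertAll K y v) fun y' => bind (glAct K x' y') h := by
  generalize hn : m.card = n
  induction n generalizing m h with
  | zero =>
    obtain rfl := Multiset.card_eq_zero.1 hn
    simp
  | succ n ih =>
    obtain ⟨τ, m, rfl, hm⟩ := Multiset.card_eq_succ_iff.1 hn
    simp only [insertAll_cons, bind_fun_sub]
    rw [ih m _ hm, bind_comm, bind_insertMon_congr fun u hu => ih u h (hu.trans hm),
      splitMon_insertMon, sub_eq_iff_eq_add]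
    simp only [bind₂_splitMon_cons, insertion_glAct, bind_fun_add, bind₂_fun_add,
      bind_comm (insertAll K _ _) (insertionNonRoot K _ _), insertion_insertAll,
      insertionNonRoot_insertAllNonRoot, bind_comm (insertAllNonRoot K _ _) (insertMon K _ _)]
    abel

end Cointeraction

section GuinOudom

variable {K : Type*} [Field K] {d : ℕ} {κ ι : Type*}

theorem bind_insertMon_ofFn {W : Type*} [AddCommMonoid W] [Module K W] (τ : PTree d κ ι) {n : ℕ}
    (v : Fin n → PTree d κ ι) (h : Multiset (PTree d κ ι) → W) :
    bind (insertMon K τ (List.ofFn v)) h =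
      ∑ j, bind (insertion K τ (v j)) fun σ => h (List.ofFn (Function.update v j σ)) := by
  induction n generalizing h with
  | zero => simp
  | succ n ih =>
    cases v using Fin.consCases with | _ σ v =>
    simp [Fin.sum_univ_succ, ← Multiset.cons_coe, bind_insertMon_cons, ih, ← Fin.cons_update]

theorem act_eq_of_recursion {I : PTree d κ ι → PTree d κ ι → (PTree d κ ι →₀ K)}
    {F : PTree d κ ι → Multiset (PTree d κ ι) → (PTree d κ ι →₀ K)}
    (zero : ∀ t, F t 0 = Finsupp.single t 1)
    (cons : ∀ τ t m, F t (τ ::ₘ m) =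
      bind (F t m) (I τ) - bind (insertMon K τ m) fun m' => F t m')
    (n : ℕ) (τ : Fin n → PTree d κ ι) (t : PTree d κ ι) :
    act K I n τ t = F t (List.ofFn τ) := by
  induction n generalizing t with
  | zero => simp [act, zero]
  | succ n ih =>
    rw [act, List.ofFn_succ, ← Multiset.cons_coe, cons, bind_insertMon_ofFn]
    simp only [ih, ← bind_eq_sum]
    rfl

theorem act_insertion (n : ℕ) (τ : Fin n → PTree d κ ι) (t : PTree d κ ι) :
    act K (insertion K) n τ t = insertAll K t (List.ofFn τ) :=
  act_eq_of_recursion insertAll_zero (fun τ t m => by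
    simpa only [bind_single_one] using
      insertAll_cons (K := K) τ t m fun u => Finsupp.single u (1 : K)) n τ t

theorem act_insertionNonRoot (n : ℕ) (τ : Fin n → PTree d κ ι) (t : PTree d κ ι) :
    act K (insertionNonRoot K) n τ t = insertAllNonRoot K t (List.ofFn τ) :=
  act_eq_of_recursion insertAllNonRoot_zero (fun τ t m => by
    simpa only [bind_single_one] using
      insertAllNonRoot_cons (K := K) τ t m fun u => Finsupp.single u (1 : K)) n τ t

/-- The factors, with multiplicity, of a monomial in the trees of negative regularity. -/
def factors {β : κ → ℝ} {α : ι → ℝ} (a : NegMon d β α) : Multiset (PTree d κ ι) :=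
  (Finsupp.toMultiset a).map Subtype.val

theorem ofFn_get_toList {β : κ → ℝ} {α : ι → ℝ} (a : NegMon d β α) :
    (List.ofFn (fun i => ((Finsupp.toMultiset a).toList.get i).1) : Multiset (PTree d κ ι)) =
      factors a := by
  rw [factors, ← Function.comp_def Subtype.val, ← List.map_ofFn, List.ofFn_get,
    ← Multiset.map_coe, Multiset.coe_toList]

theorem actMon_insertion {β : κ → ℝ} {α : ι → ℝ} (a : NegMon d β α) (t : PTree d κ ι) :
    actMon K (insertion K) a t = insertAll K t (factors a) := by
  rw [actMon, act_insertion, ofFn_get_toList]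

theorem actMon_insertionNonRoot {β : κ → ℝ} {α : ι → ℝ} (a : NegMon d β α) (t : PTree d κ ι) :
    actMon K (insertionNonRoot K) a t = insertAllNonRoot K t (factors a) := by
  rw [actMon, act_insertionNonRoot, ofFn_get_toList]

end GuinOudom

section Size

variable {d : ℕ} {κ ι : Type*}

/-- The size `|a|` of a multi-index. -/
def deg (a : Fin d → ℕ) : ℕ := ∑ j, a j

theorem deg_add (a b : Fin d → ℕ) : deg (a + b) = deg a + deg b := Finset.sum_add_distrib

@[simp] theorem deg_zero : deg (0 : Fin d → ℕ) = 0 := by simp [deg]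

namespace Forest

/-- The multiset of the kernels and noises that decorate the edges. -/
def labels : Forest d κ ι → Multiset (κ ⊕ ι)
  | nil => 0
  | noise ξ _ _ r => Sum.inr ξ ::ₘ labels r
  | kernel i _ _ s r => Sum.inl i ::ₘ (labels s + labels r)

/-- The total size of the edge decorations in `ℕ^d`. -/
def edgeDeg : Forest d κ ι → ℕ
  | nil => 0
  | noise _ a _ r => deg a + edgeDeg r
  | kernel _ a _ s r => deg a + edgeDeg s + edgeDeg r

/-- The total size of the edge decorations in `ℕ^d` without those of the edges at the root, which
are the ones that grafting lowers. -/
def innerEdgeDeg : Forest d κ ι → ℕ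
  | nil => 0
  | noise _ _ _ r => innerEdgeDeg r
  | kernel _ _ _ s r => edgeDeg s + innerEdgeDeg r

/-- The total size of the vertex decorations, the root excluded. -/
def vertexDeg : Forest d κ ι → ℕ
  | nil => 0
  | noise _ _ k r => deg k + vertexDeg r
  | kernel _ _ n s r => deg n + vertexDeg s + vertexDeg r

theorem innerEdgeDeg_le_edgeDeg (ω : Forest d κ ι) : ω.innerEdgeDeg ≤ ω.edgeDeg := by
  induction ω with
  | nil => rfl
  | noise _ _ _ _ ih | kernel _ _ _ _ _ _ ih => simp only [innerEdgeDeg, edgeDeg]; lia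

theorem labels_append (ω η : Forest d κ ι) : (ω.append η).labels = ω.labels + η.labels := by
  induction ω with
  | nil => simp [append, labels]
  | noise _ _ _ _ ih | kernel _ _ _ _ _ _ ih => simp [append, labels, ih, add_assoc]

theorem edgeDeg_append (ω η : Forest d κ ι) :
    (ω.append η).edgeDeg = ω.edgeDeg + η.edgeDeg := by
  induction ω with
  | nil => simp [append, edgeDeg]
  | noise _ _ _ _ ih | kernel _ _ _ _ _ _ ih => simp [append, edgeDeg, ih, add_assoc]

theorem vertexDeg_append (ω η : Forest d κ ι) :
    (ω.append η).vertexDeg = ω.vertexDeg + η.vertexDeg := by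
  induction ω with
  | nil => simp [append, vertexDeg]
  | noise _ _ _ _ ih | kernel _ _ _ _ _ _ ih => simp [append, vertexDeg, ih, add_assoc]

theorem rootNoise_append (ω η : Forest d κ ι) :
    (ω.append η).rootNoise = ω.rootNoise + η.rootNoise := by
  induction ω with
  | nil => simp [append, rootNoise]
  | noise _ _ _ _ ih => simp only [append, rootNoise, ih, Nat.add_right_comm]
  | kernel _ _ _ _ _ _ ih => simp only [append, rootNoise, ih]

theorem Valid.append {ω η : Forest d κ ι} (hω : ω.Valid) (hη : η.Valid)
    (rootNoise_eq_zero : ω.rootNoise = 0) : (ω.append η).Valid := by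
  induction ω with
  | nil => exact hη
  | noise => simp [rootNoise] at rootNoise_eq_zero
  | kernel i a n s r _ ih => exact ⟨hω.1, ih hω.2 rootNoise_eq_zero⟩

/-- What is preserved when the branches of `ω` are distributed over `u` and `v`. -/
structure Splits (ω u v : Forest d κ ι) : Prop where
  labels : u.labels + v.labels = ω.labels
  edgeDeg : u.edgeDeg + v.edgeDeg = ω.edgeDeg
  innerEdgeDeg : u.innerEdgeDeg + v.innerEdgeDeg = ω.innerEdgeDeg
  vertexDeg : u.vertexDeg + v.vertexDeg = ω.vertexDeg
  valid : ω.Valid → u.Valid ∧ v.Valid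

theorem splits_of_mem_deshuffle {ω : Forest d κ ι} {p : Forest d κ ι × Forest d κ ι}
    (hp : p ∈ deshuffle ω) : ω.Splits p.1 p.2 := by
  induction ω generalizing p with
  | nil =>
    simp only [deshuffle, List.mem_singleton] at hp
    subst hp
    constructor <;> simp [labels, edgeDeg, innerEdgeDeg, vertexDeg]
  | noise ξ a k r ih =>
    simp only [deshuffle, List.mem_append, List.mem_map] at hp
    rcases hp with ⟨q, hq, rfl⟩ | ⟨q, hq, rfl⟩ <;>
    · have split := ih hq
      have rootNoise_add := rootNoise_add_of_mem_deshuffle hq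
      constructor
      · simp [labels, ← split.labels]
      · simp only [edgeDeg, ← split.edgeDeg]; lia
      · simp only [innerEdgeDeg, ← split.innerEdgeDeg]
      · simp only [vertexDeg, ← split.vertexDeg]; lia
      · rintro ⟨rootNoise_eq_zero, hr⟩
        simp only [Valid, split.valid hr, and_true, true_and]
        lia
  | kernel i a n s r _ ih =>
    simp only [deshuffle, List.mem_append, List.mem_map] at hp
    rcases hp with ⟨q, hq, rfl⟩ | ⟨q, hq, rfl⟩ <;>
    · have split := ih hq
      constructor
      · simp only [labels, ← split.labels, ← Multiset.singleton_add]; abel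
      · simp only [edgeDeg, ← split.edgeDeg]; lia
      · simp only [innerEdgeDeg, ← split.innerEdgeDeg]; lia
      · simp only [vertexDeg, ← split.vertexDeg]; lia
      · exact fun hv => by simp only [Valid, split.valid hv.2, hv.1, and_self]

end Forest

/-- The total size of the vertex decorations of a tree. -/
def treeVertexDeg (t : PTree d κ ι) : ℕ := deg t.1 + t.2.vertexDeg

end Size

section Support

variable {K : Type*} [Field K] {d : ℕ} {κ ι : Type*} {A B C : Type*}

theorem eq_of_mem_support_single {a b : A} (h : b ∈ (Finsupp.single a (1 : K)).support) : b = a :=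
  Finset.mem_singleton.1 (Finsupp.support_single_subset h)

theorem exists_of_mem_support_bind {e : A →₀ K} {h : A → B →₀ K} {b : B}
    (hb : b ∈ (bind e h).support) : ∃ a ∈ e.support, b ∈ (h a).support := by
  rw [bind_eq_sum] at hb
  obtain ⟨a, ha, hb⟩ := Finsupp.mem_support_finsetSum b hb
  exact ⟨a, ha, Finsupp.support_smul hb⟩

theorem exists_of_mem_support_bind₂ {e : (A × C) →₀ K} {h : A → C → B →₀ K} {b : B}
    (hb : b ∈ (bind₂ e h).support) : ∃ a c, (a, c) ∈ e.support ∧ b ∈ (h a c).support := by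
  rw [bind₂_eq] at hb
  obtain ⟨p, hp, hb⟩ := exists_of_mem_support_bind hb
  exact ⟨p.1, p.2, hp, hb⟩

theorem mem_deshuffle_of_mem_support_splitForest {ω : Forest d κ ι}
    {p : Forest d κ ι × Forest d κ ι} (hp : p ∈ (splitForest K ω).support) :
    p ∈ deshuffle ω := by
  rw [splitForest, ← Multiset.sum_coe] at hp
  obtain ⟨e, he, hp⟩ := Finsupp.mem_support_multiset_sum p hp
  obtain ⟨q, hq, rfl⟩ := List.mem_map.1 he
  rwa [eq_of_mem_support_single hp]

theorem deg_add_of_mem_support_splitPow {m : Fin d → ℕ} {p : (Fin d → ℕ) × (Fin d → ℕ)}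
    (hp : p ∈ (splitPow K m).support) : deg p.1 + deg p.2 = deg m := by
  rw [splitPow] at hp
  obtain ⟨l, hl, hp⟩ := Finsupp.mem_support_finsetSum p hp
  rw [Finset.mem_singleton.1 (Finsupp.support_single_subset hp), ← deg_add]
  exact congrArg deg (add_tsub_cancel_of_le (Finset.mem_Icc.1 hl).2)

theorem deg_add_of_mem_support_lower {a l b : Fin d → ℕ} (hb : b ∈ (lower K a l).support) :
    deg b + deg l = deg a := by
  rw [lower] at hb
  split_ifs at hb with h
  · rw [eq_of_mem_support_single hb, ← deg_add, tsub_add_cancel_of_le h]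
  · simp at hb

theorem splits_of_mem_support_splitTree {x x₁ x₂ : PTree d κ ι}
    (h : (x₁, x₂) ∈ (splitTree K x).support) :
    deg x₁.1 + deg x₂.1 = deg x.1 ∧ x.2.Splits x₁.2 x₂.2 := by
  rw [splitTree] at h
  obtain ⟨a, b, hab, h⟩ := exists_of_mem_support_bind₂ h
  obtain ⟨u, v, huv, h⟩ := exists_of_mem_support_bind₂ h
  cases eq_of_mem_support_single h
  exact ⟨deg_add_of_mem_support_splitPow hab,
    splits_of_mem_deshuffle (mem_deshuffle_of_mem_support_splitForest huv)⟩

theorem add_eq_of_mem_support_splitMon {m u v : Multiset A}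
    (h : (u, v) ∈ (splitMon K m).support) : u + v = m := by
  rw [splitMon] at h
  obtain ⟨e, he, h⟩ := Finsupp.mem_support_multiset_sum _ h
  obtain ⟨p, hp, rfl⟩ := Multiset.mem_map.1 he
  cases eq_of_mem_support_single h
  exact Multiset.mem_antidiagonal.1 hp

theorem cons_eq_of_mem_support_pickMon {m u : Multiset A} {a : A}
    (h : (u, a) ∈ (pickMon K m).support) : a ::ₘ u = m := by
  classical
  rw [pickMon] at h
  obtain ⟨e, he, h⟩ := Finsupp.mem_support_multiset_sum _ h
  obtain ⟨b, hb, rfl⟩ := Multiset.mem_map.1 he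
  cases eq_of_mem_support_single h
  exact Multiset.cons_erase hb

end Support

section GraftingSupport

variable {K : Type*} [Field K] {d : ℕ} {κ ι : Type*}

/-- Size relations between `ω`, `n` and a term `q` of the deformed grafting `attach K ω n`: every
lowering of an edge decoration lowers the vertex decoration by the same amount. -/
structure IsAttaching (ω : Forest d κ ι) (n : Fin d → ℕ) (q : PTree d κ ι) : Prop where
  labels : q.2.labels = ω.labels
  innerEdgeDeg : q.2.innerEdgeDeg = ω.innerEdgeDeg
  vertexDeg : q.2.vertexDeg = ω.vertexDeg
  balance : q.2.edgeDeg + deg n = ω.edgeDeg + deg q.1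
  rootNoise : q.2.rootNoise = 0
  valid : ω.Valid → q.2.Valid

/-- Size relations between `x`, `y` and a term `z` of the deformed grafting `glAct K x y`. For the
grafting of `x` onto a planted forest, the roots of `y` and `z` are given decoration `0`. -/
structure IsGrafting (x y z : PTree d κ ι) : Prop where
  labels : z.2.labels = x.2.labels + y.2.labels
  balance : x.2.edgeDeg + y.2.edgeDeg + treeVertexDeg z =
    z.2.edgeDeg + treeVertexDeg x + treeVertexDeg y
  edgeDeg : y.2.edgeDeg + x.2.innerEdgeDeg ≤ z.2.edgeDeg
  vertexDeg : treeVertexDeg x ≤ treeVertexDeg z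
  rootNoise : z.2.rootNoise = y.2.rootNoise
  valid : x.2.Valid → y.2.Valid → z.2.Valid

theorem isAttaching_of_mem_support {ω : Forest d κ ι} {n : Fin d → ℕ} {q : PTree d κ ι}
    (hq : q ∈ (attach K ω n).support) : IsAttaching ω n q := by
  induction ω generalizing n q with
  | nil =>
    rw [attach] at hq
    cases eq_of_mem_support_single hq
    constructor <;> simp [rootNoise]
  | noise ξ a k r _ => simp [attach] at hq
  | kernel i a m s r _ ih =>
    rw [← bind_single_one (attach K (kernel i a m s r) n), bind_attach_kernel] at hq
    obtain ⟨l, n', hl, hq⟩ := exists_of_mem_support_bind₂ hq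
    obtain ⟨a', ha', hq⟩ := exists_of_mem_support_bind hq
    obtain ⟨p, hp, hq⟩ := exists_of_mem_support_bind hq
    cases eq_of_mem_support_single hq
    have attached := ih hp
    constructor
    · simp [labels, attached.labels]
    · simp [innerEdgeDeg, attached.innerEdgeDeg]
    · simp [vertexDeg, attached.vertexDeg]
    · have := attached.balance
      have := deg_add_of_mem_support_splitPow hl
      have := deg_add_of_mem_support_lower ha'
      simp only [edgeDeg] at *
      lia
    · exact attached.rootNoise
    · exact fun h => ⟨h.1, attached.valid h.2⟩

theorem exists_of_mem_support_glAct {x y z : PTree d κ ι} (hz : z ∈ (glAct K x y).support) :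
    ∃ x₁ x₂ q u, (x₁, x₂) ∈ (splitTree K x).support ∧ q ∈ (attach K x₁.2 y.1).support ∧
      u ∈ (graft K y.2 x₂).support ∧ z = (q.1 + x₁.1, q.2.append u) := by
  rw [← bind_single_one (glAct K x y), bind_glAct] at hz
  simp only [bind_attachTree] at hz
  obtain ⟨x₁, x₂, hx, hz⟩ := exists_of_mem_support_bind₂ hz
  obtain ⟨q, hq, hz⟩ := exists_of_mem_support_bind hz
  obtain ⟨u, hu, hz⟩ := exists_of_mem_support_bind hz
  exact ⟨x₁, x₂, q, u, hx, hq, hu, eq_of_mem_support_single hz⟩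

theorem isGrafting_of_mem_support_glAct_of_graft {x y z : PTree d κ ι}
    (isGrafting_of_mem_support_graft : ∀ {x : PTree d κ ι} {u : Forest d κ ι},
      u ∈ (graft K y.2 x).support → IsGrafting x (0, y.2) (0, u))
    (hz : z ∈ (glAct K x y).support) : IsGrafting x y z := by
  obtain ⟨x₁, x₂, q, u, hx, hq, hu, rfl⟩ := exists_of_mem_support_glAct hz
  obtain ⟨deg_add', splits⟩ := splits_of_mem_support_splitTree hx
  have attached := isAttaching_of_mem_support hq
  have grafted := isGrafting_of_mem_support_graft hu
  have vertexDeg_splits := splits.vertexDeg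
  have vertexDeg_attached := attached.vertexDeg
  constructor
  · simp only [labels_append, attached.labels, grafted.labels, ← splits.labels, add_assoc]
  · have := splits.edgeDeg
    have := attached.balance
    have := grafted.balance
    simp only [treeVertexDeg, edgeDeg_append, vertexDeg_append, deg_add, deg_zero] at *
    lia
  · have := innerEdgeDeg_le_edgeDeg q.2
    have := splits.innerEdgeDeg
    have := attached.innerEdgeDeg
    have := grafted.edgeDeg
    simp only [edgeDeg_append] at *
    lia
  · have := grafted.vertexDeg
    simp only [treeVertexDeg, vertexDeg_append, deg_add, deg_zero] at *
    lia
  · simp only [rootNoise_append, attached.rootNoise, grafted.rootNoise, zero_add]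
  · exact fun hx hy => (attached.valid (splits.valid hx).1).append
      (grafted.valid (splits.valid hx).2 hy) attached.rootNoise

theorem IsGrafting.noise {x : PTree d κ ι} {r v : Forest d κ ι}
    (grafted : IsGrafting x (0, r) (0, v)) (ξ : ι) (a k : Fin d → ℕ) :
    IsGrafting x (0, Forest.noise ξ a k r) (0, Forest.noise ξ a k v) := by
  constructor
  · simp [Forest.labels, grafted.labels]
  · have := grafted.balance
    simp only [treeVertexDeg, Forest.edgeDeg, Forest.vertexDeg] at *
    lia
  · have := grafted.edgeDeg
    simp only [Forest.edgeDeg] at *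
    lia
  · have := grafted.vertexDeg
    simp only [treeVertexDeg, Forest.vertexDeg] at *
    lia
  · exact congrArg (· + 1) grafted.rootNoise
  · exact fun hx hy => ⟨grafted.rootNoise.trans hy.1, grafted.valid hx hy.2⟩

theorem IsGrafting.kernel {x x₁ x₂ t : PTree d κ ι} {n : Fin d → ℕ} {s r v : Forest d κ ι}
    (deg_add : deg x₁.1 + deg x₂.1 = deg x.1) (splits : x.2.Splits x₁.2 x₂.2)
    (subtree : IsGrafting x₁ (n, s) t) (rest : IsGrafting x₂ (0, r) (0, v))
    (i : κ) (a : Fin d → ℕ) :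
    IsGrafting x (0, Forest.kernel i a n s r) (0, Forest.kernel i a t.1 t.2 v) := by
  have vertexDeg_splits := splits.vertexDeg
  constructor
  · simp only [Forest.labels, rest.labels, subtree.labels, ← splits.labels,
      ← Multiset.singleton_add]
    abel
  · have := splits.edgeDeg
    have := subtree.balance
    have := rest.balance
    simp only [treeVertexDeg, Forest.edgeDeg, Forest.vertexDeg, deg_zero] at *
    lia
  · have := splits.innerEdgeDeg
    have := subtree.edgeDeg
    have := rest.edgeDeg
    simp only [Forest.edgeDeg] at *
    lia
  · have := subtree.vertexDeg
    have := rest.vertexDeg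
    simp only [treeVertexDeg, Forest.vertexDeg, deg_zero] at *
    lia
  · exact rest.rootNoise
  · exact fun hx hy =>
      ⟨subtree.valid (splits.valid hx).1 hy.1, rest.valid (splits.valid hx).2 hy.2⟩

theorem isGrafting_of_mem_support_graft {η : Forest d κ ι} {x : PTree d κ ι} {u : Forest d κ ι}
    (hu : u ∈ (graft K η x).support) : IsGrafting x (0, η) (0, u) := by
  rw [← bind_single_one (graft K η x)] at hu
  induction η generalizing x u with
  | nil =>
    classical
    rw [bind_graft_nil] at hu
    split_ifs at hu with h
    · cases eq_of_mem_support_single hu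
      subst h
      constructor <;> simp [labels, edgeDeg, vertexDeg, innerEdgeDeg, treeVertexDeg]
    · simp at hu
  | noise ξ a k r ih =>
    rw [bind_graft_noise] at hu
    obtain ⟨v, hv, hu⟩ := exists_of_mem_support_bind hu
    cases eq_of_mem_support_single hu
    exact (ih (by rwa [bind_single_one])).noise ξ a k
  | kernel i a n s r ihs ihr =>
    rw [bind_graft_kernel] at hu
    obtain ⟨x₁, x₂, hx, hu⟩ := exists_of_mem_support_bind₂ hu
    obtain ⟨t, ht, hu⟩ := exists_of_mem_support_bind hu
    obtain ⟨v, hv, hu⟩ := exists_of_mem_support_bind hu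
    cases eq_of_mem_support_single hu
    obtain ⟨deg_add, splits⟩ := splits_of_mem_support_splitTree hx
    exact .kernel deg_add splits
      (isGrafting_of_mem_support_glAct_of_graft (fun hu => ihs (by rwa [bind_single_one])) ht)
      (ihr (by rwa [bind_single_one])) i a

theorem isGrafting_of_mem_support_glAct {x y z : PTree d κ ι} (hz : z ∈ (glAct K x y).support) :
    IsGrafting x y z :=
  isGrafting_of_mem_support_glAct_of_graft isGrafting_of_mem_support_graft hz

end GraftingSupport

section InsertionSupport

variable {K : Type*} [Field K] {d : ℕ} {κ ι : Type*}

/-- The multiset of all edge labels of the factors of a monomial of trees. -/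
def monLabels (m : Multiset (PTree d κ ι)) : Multiset (κ ⊕ ι) := (m.map fun t => t.2.labels).sum

/-- The total size of the edge decorations of the factors of a monomial of trees. -/
def monEdgeDeg (m : Multiset (PTree d κ ι)) : ℕ := (m.map fun t => t.2.edgeDeg).sum

/-- The total size of the vertex decorations of the factors of a monomial of trees. -/
def monVertexDeg (m : Multiset (PTree d κ ι)) : ℕ := (m.map treeVertexDeg).sum

/-- Size relations between `t`, a monomial `m` and a term `z` of the simultaneous insertion
`insertAll K t m`. -/
structure IsInsertion (t : PTree d κ ι) (m : Multiset (PTree d κ ι)) (z : PTree d κ ι) : Prop where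
  labels : z.2.labels = t.2.labels + monLabels m
  edgeDeg : monEdgeDeg m ≤ z.2.edgeDeg
  vertexDeg : treeVertexDeg t ≤ treeVertexDeg z
  balance : t.2.edgeDeg + monEdgeDeg m + treeVertexDeg z =
    z.2.edgeDeg + treeVertexDeg t + monVertexDeg m
  valid : t.2.Valid → (∀ σ ∈ m, σ.2.Valid) → z.2.Valid

/-- Size relations between `t`, a monomial `m` and a term `z` of `insertAllNonRoot K t m`. For the
insertion into a planted forest, the roots of `t` and `z` are given decoration `0`. -/
structure IsNonRootInsertion (t : PTree d κ ι) (m : Multiset (PTree d κ ι)) (z : PTree d κ ι) : Prop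
    extends IsInsertion t m z where
  innerEdgeDeg : monEdgeDeg m ≤ z.2.innerEdgeDeg
  rootNoise : z.2.rootNoise = t.2.rootNoise

theorem IsNonRootInsertion.root_decoration {s u : Forest d κ ι} {m : Multiset (PTree d κ ι)}
    (inserted : IsNonRootInsertion (0, s) m (0, u)) (n : Fin d → ℕ) :
    IsNonRootInsertion (n, s) m (n, u) := by
  refine ⟨⟨inserted.labels, inserted.edgeDeg, ?_, ?_, inserted.valid⟩,
    inserted.innerEdgeDeg, inserted.rootNoise⟩
  · have := inserted.vertexDeg
    simp only [treeVertexDeg, deg_zero] at *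
    lia
  · have := inserted.balance
    simp only [treeVertexDeg, deg_zero] at *
    lia

theorem isInsertion_of_mem_support_insertAll_of_insertAllForest {t z : PTree d κ ι}
    {m : Multiset (PTree d κ ι)}
    (isInsertion_of_mem_support_insertAllForest : ∀ {m : Multiset (PTree d κ ι)}
      {u : Forest d κ ι}, u ∈ (insertAllForest K t.2 m).support →
        IsNonRootInsertion (0, t.2) m (0, u))
    (hz : z ∈ (insertAll K t m).support) : IsInsertion t m z := by
  classical
  rw [insertAll, insertAllRoot] at hz
  rcases Finset.mem_union.1 (Finsupp.support_add hz) with hz | hz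
  · obtain ⟨u, hu, hz⟩ := exists_of_mem_support_bind hz
    cases eq_of_mem_support_single hz
    exact ((isInsertion_of_mem_support_insertAllForest hu).root_decoration t.1).toIsInsertion
  · obtain ⟨v, σ, hv, hz⟩ := exists_of_mem_support_bind₂ hz
    obtain ⟨u, hu, hz⟩ := exists_of_mem_support_bind hz
    have inserted := (isInsertion_of_mem_support_insertAllForest hu).root_decoration t.1
    have grafted := isGrafting_of_mem_support_glAct hz
    cases cons_eq_of_mem_support_pickMon hv
    constructor
    · simp only [grafted.labels, inserted.labels, monLabels, Multiset.map_cons,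
        Multiset.sum_cons, add_assoc, add_comm (Multiset.sum _)]
    · have := inserted.innerEdgeDeg
      have := grafted.edgeDeg
      simp only [monEdgeDeg, Multiset.map_cons, Multiset.sum_cons] at *
      lia
    · exact inserted.vertexDeg.trans grafted.vertexDeg
    · have := inserted.balance
      have := grafted.balance
      simp only [monEdgeDeg, monVertexDeg, Multiset.map_cons, Multiset.sum_cons] at *
      lia
    · exact fun ht hm => grafted.valid (inserted.valid ht fun ρ hρ =>
        hm ρ (Multiset.mem_cons_of_mem hρ)) (hm σ (Multiset.mem_cons_self σ v))

theorem IsNonRootInsertion.noise {r v : Forest d κ ι} {m : Multiset (PTree d κ ι)}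
    (inserted : IsNonRootInsertion (0, r) m (0, v)) (ξ : ι) (a k : Fin d → ℕ) :
    IsNonRootInsertion (0, Forest.noise ξ a k r) m (0, Forest.noise ξ a k v) := by
  refine ⟨⟨by simp [Forest.labels, inserted.labels], ?_, ?_, ?_, fun hr hm =>
    ⟨inserted.rootNoise.trans hr.1, inserted.valid hr.2 hm⟩⟩, inserted.innerEdgeDeg,
    congrArg (· + 1) inserted.rootNoise⟩
  · exact inserted.edgeDeg.trans (Nat.le_add_left _ _)
  · have := inserted.vertexDeg
    simp only [treeVertexDeg, Forest.vertexDeg] at *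
    lia
  · have := inserted.balance
    simp only [treeVertexDeg, Forest.edgeDeg, Forest.vertexDeg] at *
    lia

theorem IsNonRootInsertion.kernel {n : Fin d → ℕ} {s r u : Forest d κ ι}
    {v w : Multiset (PTree d κ ι)} {t : PTree d κ ι} (subtree : IsInsertion (n, s) v t)
    (rest : IsNonRootInsertion (0, r) w (0, u)) (i : κ) (a : Fin d → ℕ) :
    IsNonRootInsertion (0, Forest.kernel i a n s r) (v + w)
      (0, Forest.kernel i a t.1 t.2 u) := by
  have edgeDeg_subtree := subtree.edgeDeg
  refine ⟨⟨?_, ?_, ?_, ?_, fun hs hm => ⟨subtree.valid hs.1 fun σ hσ =>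
    hm σ (Multiset.mem_add.2 (.inl hσ)), rest.valid hs.2 fun σ hσ =>
    hm σ (Multiset.mem_add.2 (.inr hσ))⟩⟩, ?_, rest.rootNoise⟩
  · simp only [Forest.labels, rest.labels, subtree.labels, monLabels, Multiset.map_add,
      Multiset.sum_add, ← Multiset.singleton_add]
    abel
  · have := rest.edgeDeg
    simp only [monEdgeDeg, Forest.edgeDeg, Multiset.map_add, Multiset.sum_add] at *
    lia
  · have := rest.vertexDeg
    have := subtree.vertexDeg
    simp only [treeVertexDeg, Forest.vertexDeg, deg_zero] at *
    lia
  · have := rest.balance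
    have := subtree.balance
    simp only [treeVertexDeg, monEdgeDeg, monVertexDeg, Forest.edgeDeg, Forest.vertexDeg,
      deg_zero, Multiset.map_add, Multiset.sum_add] at *
    lia
  · have := rest.innerEdgeDeg
    simp only [monEdgeDeg, Forest.innerEdgeDeg, Multiset.map_add, Multiset.sum_add] at *
    lia

theorem isNonRootInsertion_of_mem_support_insertAllForest {η : Forest d κ ι}
    {m : Multiset (PTree d κ ι)} {u : Forest d κ ι} (hu : u ∈ (insertAllForest K η m).support) :
    IsNonRootInsertion (0, η) m (0, u) := by
  induction η generalizing m u with
  | nil =>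
    rw [insertAllForest] at hu
    split_ifs at hu with h
    · cases eq_of_mem_support_single hu
      subst h
      exact ⟨⟨by simp [monLabels], by simp [monEdgeDeg], le_rfl,
        by simp [monEdgeDeg, monVertexDeg], fun h _ => h⟩, by simp [monEdgeDeg], rfl⟩
    · simp at hu
  | noise ξ a k r ih =>
    rw [insertAllForest] at hu
    obtain ⟨v, hv, hu⟩ := exists_of_mem_support_bind hu
    cases eq_of_mem_support_single hu
    exact (ih hv).noise ξ a k
  | kernel i a n s r ihs ihr =>
    rw [insertAllForest] at hu
    obtain ⟨v, w, hvw, hu⟩ := exists_of_mem_support_bind₂ hu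
    obtain ⟨t, ht, hu⟩ := exists_of_mem_support_bind hu
    obtain ⟨u', hu', hu⟩ := exists_of_mem_support_bind hu
    cases eq_of_mem_support_single hu
    cases add_eq_of_mem_support_splitMon hvw
    exact .kernel (isInsertion_of_mem_support_insertAll_of_insertAllForest ihs ht) (ihr hu') i a

theorem isInsertion_of_mem_support_insertAll {t z : PTree d κ ι} {m : Multiset (PTree d κ ι)}
    (hz : z ∈ (insertAll K t m).support) : IsInsertion t m z :=
  isInsertion_of_mem_support_insertAll_of_insertAllForest
    isNonRootInsertion_of_mem_support_insertAllForest hz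

theorem isNonRootInsertion_of_mem_support_insertAllNonRoot {t z : PTree d κ ι}
    {m : Multiset (PTree d κ ι)} (hz : z ∈ (insertAllNonRoot K t m).support) :
    IsNonRootInsertion t m z := by
  rw [insertAllNonRoot] at hz
  obtain ⟨u, hu, hz⟩ := exists_of_mem_support_bind hz
  cases eq_of_mem_support_single hz
  exact (isNonRootInsertion_of_mem_support_insertAllForest hu).root_decoration t.1

end InsertionSupport

section Finiteness

variable {d : ℕ} {κ ι : Type*}

theorem finite_setOf_deg_le (c : ℕ) : {a : Fin d → ℕ | deg a ≤ c}.Finite :=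
  (Set.finite_Iic fun _ => c).subset fun _ ha i =>
    (Finset.single_le_sum (fun _ _ => Nat.zero_le _) (Finset.mem_univ i)).trans ha

theorem finite_setOf_forest_of_card_labels_le {S : Set (κ ⊕ ι)} (hS : S.Finite) (c k : ℕ) :
    {f : Forest d κ ι | (∀ l ∈ f.labels, l ∈ S) ∧ f.edgeDeg ≤ c ∧ f.vertexDeg ≤ c ∧
      f.labels.card ≤ k}.Finite := by
  induction k with
  | zero =>
    refine (Set.finite_singleton nil).subset fun f hf => ?_
    cases f with
    | nil => rfl
    | noise | kernel => simp [labels] at hf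
  | succ k ih =>
    have hD := finite_setOf_deg_le (d := d) c
    have noises := ((hS.preimage Sum.inr_injective.injOn).prod (hD.prod (hD.prod ih))).image
      fun p => noise p.1 p.2.1 p.2.2.1 p.2.2.2
    have kernels :=
      ((hS.preimage Sum.inl_injective.injOn).prod (hD.prod (hD.prod (ih.prod ih)))).image
        fun p => kernel p.1 p.2.1 p.2.2.1 p.2.2.2.1 p.2.2.2.2
    refine ((Set.finite_singleton nil).union (noises.union kernels)).subset fun f hf => ?_
    cases f with
    | nil => exact .inl rfl
    | noise ξ a m r =>
      simp only [Set.mem_ofPred_eq, labels, Multiset.card_cons, Multiset.mem_cons,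
        forall_eq_or_imp, edgeDeg, vertexDeg] at hf
      refine .inr (.inl ⟨(ξ, a, m, r), ⟨hf.1.1, ?_⟩, rfl⟩)
      simp only [Set.mem_prod, Set.mem_ofPred_eq]
      exact ⟨by lia, by lia, hf.1.2, by lia, by lia, by lia⟩
    | kernel i a n s r =>
      simp only [Set.mem_ofPred_eq, labels, Multiset.card_cons, Multiset.mem_cons,
        forall_eq_or_imp, edgeDeg, vertexDeg, Multiset.card_add, Multiset.mem_add] at hf
      refine .inr (.inr ⟨(i, a, n, s, r), ⟨hf.1.1, ?_⟩, rfl⟩)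
      simp only [Set.mem_prod, Set.mem_ofPred_eq]
      exact ⟨by lia, by lia, ⟨fun l hl => hf.1.2 l (.inl hl), by lia, by lia, by lia⟩,
        fun l hl => hf.1.2 l (.inr hl), by lia, by lia, by lia⟩

theorem finite_setOf_tree (L : Multiset (κ ⊕ ι)) (c : ℕ) :
    {t : PTree d κ ι | t.2.labels ≤ L ∧ t.2.edgeDeg ≤ c ∧ treeVertexDeg t ≤ c}.Finite := by
  classical
  refine ((finite_setOf_deg_le c).prod (finite_setOf_forest_of_card_labels_le
    L.toFinset.finite_toSet c L.card)).subset fun t ht => ?_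
  obtain ⟨hL, he, hv⟩ := ht
  rw [treeVertexDeg] at hv
  refine ⟨show deg t.1 ≤ c by lia, fun l hl => ?_, he, by lia, Multiset.card_le_card hL⟩
  exact Multiset.mem_toFinset.2 (Multiset.mem_of_le hL hl)

/-- The contribution of an edge to the regularity, up to the size of its decoration in `ℕ^d`. -/
def labelReg (β : κ → ℝ) (α : ι → ℝ) : κ ⊕ ι → ℝ := Sum.elim β fun ξ => α ξ - 1

theorem forest_reg_eq (β : κ → ℝ) (α : ι → ℝ) (f : Forest d κ ι) :
    f.reg β α = (f.labels.map (labelReg β α)).sum - f.edgeDeg + f.vertexDeg := by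
  induction f with
  | nil => simp [Forest.reg, labels, edgeDeg, vertexDeg]
  | noise ξ a k r ih => simp [Forest.reg, labels, edgeDeg, vertexDeg, ih, deg, labelReg]; ring
  | kernel i a n s r ihs ihr =>
    simp [Forest.reg, labels, edgeDeg, vertexDeg, ihs, ihr, deg, labelReg]; ring

theorem reg_eq (β : κ → ℝ) (α : ι → ℝ) (t : PTree d κ ι) :
    reg β α t = (t.2.labels.map (labelReg β α)).sum - t.2.edgeDeg + treeVertexDeg t := by
  rw [reg, forest_reg_eq, treeVertexDeg, deg]
  push_cast
  ring

theorem treeVertexDeg_le_of_reg_neg {β : κ → ℝ} {α : ι → ℝ} {t : PTree d κ ι}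
    {L : Multiset (κ ⊕ ι)} (ht : reg β α t < 0) (hL : t.2.labels ≤ L) :
    (treeVertexDeg t : ℝ) ≤ (L.map fun l => |labelReg β α l|).sum + t.2.edgeDeg := by
  obtain ⟨M, rfl⟩ := Multiset.le_iff_exists_add.1 hL
  have neg_sum_le : (t.2.labels.map fun l => -labelReg β α l).sum ≤
      (t.2.labels.map fun l => |labelReg β α l|).sum :=
    Multiset.sum_map_le_sum_map _ _ fun l _ => neg_le_abs _
  have sum_nonneg : 0 ≤ (M.map fun l => |labelReg β α l|).sum :=
    Multiset.sum_nonneg <| Multiset.forall_mem_map_iff.2 fun l _ => abs_nonneg _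
  rw [Multiset.sum_map_neg] at neg_sum_le
  rw [reg_eq] at ht
  rw [Multiset.map_add, Multiset.sum_add]
  linarith

theorem card_labels_pos_of_reg_neg {β : κ → ℝ} {α : ι → ℝ} {t : PTree d κ ι}
    (ht : reg β α t < 0) : 0 < t.2.labels.card := by
  obtain ⟨n, f⟩ := t
  cases f with
  | nil =>
    rw [reg, Forest.reg, add_zero] at ht
    exact absurd ht (not_lt.2 (Finset.sum_nonneg fun _ _ => Nat.cast_nonneg _))
  | noise | kernel => simp [labels]

theorem finite_setOf_negTree (β : κ → ℝ) (α : ι → ℝ) (L : Multiset (κ ⊕ ι)) (c : ℕ) :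
    {τ : NegTree d β α | τ.1.2.labels ≤ L ∧ τ.1.2.edgeDeg ≤ c}.Finite := by
  obtain ⟨b, hb⟩ := exists_nat_ge ((L.map fun l => |labelReg β α l|).sum + c)
  refine .of_injOn (f := Subtype.val) (fun τ hτ => ?_) Subtype.val_injective.injOn
    (finite_setOf_tree L (b + c))
  refine ⟨hτ.1, hτ.2.trans (Nat.le_add_left c b), le_trans ?_ (Nat.le_add_right b c)⟩
  have hc : (τ.1.2.edgeDeg : ℝ) ≤ c := by exact_mod_cast hτ.2
  have := treeVertexDeg_le_of_reg_neg τ.2.2 hτ.1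
  exact_mod_cast (show (treeVertexDeg τ.1 : ℝ) ≤ b by linarith)

theorem finite_setOf_finsupp_le {A : Type*} {S : Set A} (hS : S.Finite) (k : ℕ) :
    {a : A →₀ ℕ | ∀ x, a x ≠ 0 → x ∈ S ∧ a x ≤ k}.Finite := by
  classical
  refine (Set.finite_Iic (Finsupp.indicator hS.toFinset fun _ _ => k)).subset fun a ha x => ?_
  by_cases hx : a x = 0
  · simp [hx]
  · obtain ⟨hxS, le⟩ := ha x hx
    simpa [Finsupp.indicator_apply, hxS] using le

theorem labels_le_monLabels {m : Multiset (PTree d κ ι)} {σ : PTree d κ ι} (hσ : σ ∈ m) :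
    σ.2.labels ≤ monLabels m :=
  Multiset.single_le_sum (fun _ _ => Multiset.zero_le _) _
    (Multiset.mem_map_of_mem (fun t : PTree d κ ι => t.2.labels) hσ)

theorem edgeDeg_le_monEdgeDeg {m : Multiset (PTree d κ ι)} {σ : PTree d κ ι} (hσ : σ ∈ m) :
    σ.2.edgeDeg ≤ monEdgeDeg m :=
  Multiset.single_le_sum (fun _ _ => Nat.zero_le _) _
    (Multiset.mem_map_of_mem (fun t : PTree d κ ι => t.2.edgeDeg) hσ)

theorem card_le_card_monLabels {β : κ → ℝ} {α : ι → ℝ} {m : Multiset (PTree d κ ι)}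
    (hm : ∀ σ ∈ m, reg β α σ < 0) : m.card ≤ (monLabels m).card := by
  calc m.card = (m.map fun _ => 1).sum := by simp
    _ ≤ (m.map fun t => t.2.labels.card).sum :=
      Multiset.sum_map_le_sum_map _ _ fun σ hσ => card_labels_pos_of_reg_neg (hm σ hσ)
    _ = (monLabels m).card := by
      rw [monLabels, ← Multiset.cardHom_apply, map_multiset_sum, Multiset.map_map]
      rfl

theorem finite_setOf_monomial (β : κ → ℝ) (α : ι → ℝ) (L : Multiset (κ ⊕ ι)) (c : ℕ) :
    {a : NegMon d β α | monLabels (factors a) ≤ L ∧ monEdgeDeg (factors a) ≤ c}.Finite := by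
  classical
  refine (finite_setOf_finsupp_le (finite_setOf_negTree β α L c) L.card).subset
    fun a ha τ hτ => ?_
  rw [← Finsupp.count_toMultiset, ← Nat.pos_iff_ne_zero, Multiset.count_pos] at hτ
  have mem_factors : τ.1 ∈ factors a := Multiset.mem_map_of_mem _ hτ
  refine ⟨⟨(labels_le_monLabels mem_factors).trans ha.1,
    (edgeDeg_le_monEdgeDeg mem_factors).trans ha.2⟩, ?_⟩
  calc a τ ≤ (Finsupp.toMultiset a).card := by
        rw [← Finsupp.count_toMultiset]
        exact Multiset.count_le_card _ _
    _ = (factors a).card := (Multiset.card_map _ _).symm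
    _ ≤ (monLabels (factors a)).card := card_le_card_monLabels fun σ hσ => by
        obtain ⟨ρ, -, rfl⟩ := Multiset.mem_map.1 hσ
        exact ρ.2.2
    _ ≤ L.card := Multiset.card_le_card ha.1

theorem finite_setOf_isInsertion (β : κ → ℝ) (α : ι → ℝ) (z : PTree d κ ι) :
    {p : NegMon d β α × Tree d κ ι | IsInsertion p.2.1 (factors p.1) z}.Finite := by
  have finite_trees (a : NegMon d β α) :
      {t : Tree d κ ι | IsInsertion t.1 (factors a) z}.Finite := by
    refine .of_injOn (f := Subtype.val) (fun t ht => ?_) Subtype.val_injective.injOn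
      (finite_setOf_tree z.2.labels (z.2.edgeDeg + treeVertexDeg z + monVertexDeg (factors a)))
    have := ht.vertexDeg
    have := ht.balance
    exact ⟨ht.labels ▸ Multiset.le_add_right _ _, by lia, by lia⟩
  refine ((finite_setOf_monomial β α z.2.labels z.2.edgeDeg).biUnion fun a _ =>
    (finite_trees a).image (Prod.mk a)).subset ?_
  rintro ⟨a, t⟩ hp
  exact Set.mem_biUnion ⟨hp.labels ▸ Multiset.le_add_left _ _, hp.edgeDeg⟩ ⟨t, hp, rfl⟩

end Finiteness

section DividedPowers

open Finset.HasAntidiagonal (antidiagonal mem_antidiagonal)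

variable (K : Type*) [CommSemiring K] {J : Type*}

/-- The factorial `a! = ∏ j, (a j)!` of a multi-index, the square norm of a monomial. -/
def monFactorial (a : J →₀ ℕ) : K := a.prod fun _ k => (k.factorial : K)

theorem monFactorial_add_single (a : J →₀ ℕ) (j : J) :
    monFactorial K (a + Finsupp.single j 1) = ((a j : K) + 1) * monFactorial K a := by
  have eq_mul_erase (b : J →₀ ℕ) :
      monFactorial K b = (b j).factorial * monFactorial K (b.erase j) :=
    (Finsupp.mul_prod_erase' b j (fun _ k => (k.factorial : K)) (by simp)).symm
  rw [eq_mul_erase, eq_mul_erase a, Finsupp.erase_add, Finsupp.erase_single, add_zero]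
  simp [Nat.factorial_succ, mul_assoc]

theorem monFactorial_ne_zero [NoZeroDivisors K] [CharZero K] (a : J →₀ ℕ) :
    monFactorial K a ≠ 0 :=
  Finset.prod_ne_zero_iff.2 fun _ _ => Nat.cast_ne_zero.2 (Nat.factorial_ne_zero _)

theorem add_one_mul_inv_monFactorial (K : Type*) [Field K] [CharZero K] (a : J →₀ ℕ) (j : J) :
    ((a j : K) + 1) * (monFactorial K (a + Finsupp.single j 1))⁻¹ = (monFactorial K a)⁻¹ := by
  rw [monFactorial_add_single, mul_inv, mul_inv_cancel_left₀ (Nat.cast_add_one_ne_zero _)]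

variable {K} {A W : Type*} [AddCommMonoid W] [Module K W]

open Classical in
theorem sum_antidiagonal_smul_fst (a : J →₀ ℕ) (j : J) (H : (J →₀ ℕ) → (J →₀ ℕ) → W) :
    ∑ p ∈ antidiagonal (a + Finsupp.single j 1 : J →₀ ℕ), (p.1 j : K) • H p.1 p.2 =
      ∑ p ∈ antidiagonal a, ((p.1 j : K) + 1) • H (p.1 + Finsupp.single j 1) p.2 := by
  refine (Finset.sum_of_injOn (fun p => (p.1 + Finsupp.single j 1, p.2)) ?_ ?_ ?_ ?_).symm
  · rintro ⟨b, c⟩ _ ⟨b', c'⟩ _ h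
    simpa using h
  · intro p hp
    simp only [Finset.mem_coe, mem_antidiagonal] at hp ⊢
    rw [← hp, add_right_comm]
  · rintro ⟨b, c⟩ hp not_mem
    have hb : b j = 0 := by
      by_contra hb
      have hb' : b - Finsupp.single j 1 + Finsupp.single j 1 = b :=
        tsub_add_cancel_of_le (Finsupp.single_le_iff.2 (Nat.one_le_iff_ne_zero.2 hb))
      refine not_mem ⟨(b - Finsupp.single j 1, c), ?_, by simp only [hb']⟩
      rw [Finset.mem_coe, mem_antidiagonal] at *
      exact add_right_cancel (b := Finsupp.single j 1) (by rw [← hp, add_right_comm, hb'])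
    simp [hb]
  · simp

open Classical in
theorem sum_antidiagonal_smul_snd (a : J →₀ ℕ) (j : J) (H : (J →₀ ℕ) → (J →₀ ℕ) → W) :
    ∑ p ∈ antidiagonal (a + Finsupp.single j 1 : J →₀ ℕ), (p.2 j : K) • H p.1 p.2 =
      ∑ p ∈ antidiagonal a, ((p.2 j : K) + 1) • H p.1 (p.2 + Finsupp.single j 1) :=
  (Finsupp.sum_antidiagonal_swap _ fun b c => (c j : K) • H b c).trans <|
    (sum_antidiagonal_smul_fst a j fun b c => H c b).trans <|
      Finsupp.sum_antidiagonal_swap a fun b c => ((b j : K) + 1) • H c (b + Finsupp.single j 1)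

open Classical in
theorem add_one_smul_sum_antidiagonal (a : J →₀ ℕ) (j : J) (H : (J →₀ ℕ) → (J →₀ ℕ) → W) :
    ((a j : K) + 1) • ∑ p ∈ antidiagonal (a + Finsupp.single j 1 : J →₀ ℕ), H p.1 p.2 =
      ∑ p ∈ antidiagonal a, (((p.1 j : K) + 1) • H (p.1 + Finsupp.single j 1) p.2 +
        ((p.2 j : K) + 1) • H p.1 (p.2 + Finsupp.single j 1)) := by
  rw [Finset.sum_add_distrib, ← sum_antidiagonal_smul_fst, ← sum_antidiagonal_smul_snd,
    ← Finset.sum_add_distrib, Finset.smul_sum]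
  refine Finset.sum_congr rfl fun p hp => ?_
  have apply_eq := DFunLike.congr_fun (mem_antidiagonal.1 hp) j
  simp only [Finsupp.add_apply, Finsupp.single_eq_same] at apply_eq
  rw [← add_smul, ← Nat.cast_add, apply_eq, Nat.cast_add, Nat.cast_one]

open Classical in
theorem bind₂_splitMon_toMultiset {K : Type*} [Field K] [CharZero K] [Module K W] (f : J → A)
    (a : J →₀ ℕ) (F : Multiset A → Multiset A → W) :
    bind₂ (splitMon K ((Finsupp.toMultiset a).map f)) F =
      monFactorial K a • ∑ p ∈ antidiagonal a,
        ((monFactorial K p.1)⁻¹ * (monFactorial K p.2)⁻¹) •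
          F ((Finsupp.toMultiset p.1).map f) ((Finsupp.toMultiset p.2).map f) := by
  obtain ⟨s, rfl⟩ : ∃ s, a = Multiset.toFinsupp s := ⟨_, (Finsupp.toMultiset_toFinsupp a).symm⟩
  induction s using Multiset.induction generalizing F with
  | empty => simp [monFactorial]
  | cons j s ih =>
    have toFinsupp_cons :
        Multiset.toFinsupp (j ::ₘ s) = Multiset.toFinsupp s + Finsupp.single j 1 := by
      rw [← Multiset.singleton_add, map_add, Multiset.toFinsupp_singleton, add_comm]
    have map_toMultiset (b : J →₀ ℕ) : (Finsupp.toMultiset (b + Finsupp.single j 1)).map f =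
        f j ::ₘ (Finsupp.toMultiset b).map f := by
      rw [map_add, Finsupp.toMultiset_single, one_smul, add_comm, Multiset.singleton_add,
        Multiset.map_cons]
    rw [toFinsupp_cons, map_toMultiset, bind₂_splitMon_cons, ih, monFactorial_add_single, mul_comm,
      mul_smul, add_one_smul_sum_antidiagonal _ j fun b c =>
        ((monFactorial K b)⁻¹ * (monFactorial K c)⁻¹) •
          F ((Finsupp.toMultiset b).map f) ((Finsupp.toMultiset c).map f)]
    have inv_mul_inv_snd (b c : J →₀ ℕ) : ((c j : K) + 1) *
        ((monFactorial K b)⁻¹ * (monFactorial K (c + Finsupp.single j 1))⁻¹) =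
          (monFactorial K b)⁻¹ * (monFactorial K c)⁻¹ := by
      rw [mul_left_comm, add_one_mul_inv_monFactorial]
    simp only [smul_add, smul_smul, map_toMultiset, inv_mul_inv_snd, ← mul_assoc,
      add_one_mul_inv_monFactorial]

end DividedPowers

section Coefficients

variable {K : Type*} [CommSemiring K] {A A' B B' : Type*}

theorem finsum_mul_eq_bind {g : A' → A} (hg : Function.Injective g) {e : A →₀ K}
    (he : ↑e.support ⊆ Set.range g) (φ : A → K) :
    ∑ᶠ a' : A', φ (g a') * e (g a') = bind e φ := by
  classical
  rw [finsum_eq_sum_of_support_subset (s := e.support.preimage g hg.injOn),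
    Finset.sum_preimage g _ hg.injOn (fun a => φ a * e a) fun a ha h => absurd (he ha) h,
    bind_eq_sum, Finsupp.sum]
  · simp only [smul_eq_mul, mul_comm]
  · intro a' ha'
    simp only [Finset.coe_preimage, Set.mem_preimage, Finset.mem_coe, Finsupp.mem_support_iff]
    exact right_ne_zero_of_mul ha'

theorem finsum_mul_mul_eq_bind [NoZeroDivisors K] {g : A' → A} (hg : Function.Injective g)
    {e : A →₀ K} (he : ↑e.support ⊆ Set.range g) {k : B' → B} (hk : Function.Injective k)
    {f : B →₀ K} (hf : ↑f.support ⊆ Set.range k) (φ : A → B → K) :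
    ∑ᶠ p : A' × B', φ (g p.1) (k p.2) * (e (g p.1) * f (k p.2)) =
      bind e fun a => bind f fun b => φ a b := by
  rw [finsum_curry]
  · have inner (a' : A') : ∑ᶠ b' : B', φ (g a') (k b') * (e (g a') * f (k b')) =
        (bind f fun b => φ (g a') b) * e (g a') := by
      rw [← finsum_mul_eq_bind hk hf, finsum_mul]
      exact finsum_congr fun b' => by ring
    simp only [inner]
    exact finsum_mul_eq_bind hg he fun a => bind f fun b => φ a b
  · refine ((e.support.finite_toSet.preimage hg.injOn).prod
      (f.support.finite_toSet.preimage hk.injOn)).subset fun p hp => ?_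
    have mul_ne_zero := right_ne_zero_of_mul hp
    exact ⟨Finsupp.mem_support_iff.2 (left_ne_zero_of_mul mul_ne_zero),
      Finsupp.mem_support_iff.2 (right_ne_zero_of_mul mul_ne_zero)⟩

theorem tensorMap_idMap {K : Type*} [Field K] {A C D : Type*} (g : C → Ser K D)
    (F : Ser K (A × C)) (a : A) (q : D) :
    tensorMap K (idMap K A) g F (a, q) = ∑ᶠ c, F (a, c) * g c q := by
  classical
  rw [tensorMap, ← finsum_mem_range (f := fun p : A × C => F p * g p.2 q)
    (Prod.mk_right_injective a), finsum_mem_def]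
  refine finsum_congr fun ⟨a', c⟩ => ?_
  rcases eq_or_ne a' a with rfl | ha
  · simp [idMap]
  · simp [idMap, ha, ha.symm]

end Coefficients

section Coactions

variable {K : Type*} [Field K] {d : ℕ} {κ ι : Type*} {β : κ → ℝ} {α : ι → ℝ}

theorem valid_of_mem_factors {a : NegMon d β α} {σ : PTree d κ ι} (hσ : σ ∈ factors a) :
    σ.2.Valid := by
  obtain ⟨τ, -, rfl⟩ := Multiset.mem_map.1 hσ
  exact τ.2.1

theorem support_glAct_subset_range (x y : Tree d κ ι) :
    ↑(glAct K x.1 y.1).support ⊆ Set.range (Subtype.val : Tree d κ ι → PTree d κ ι) :=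
  fun t ht => ⟨⟨t, (isGrafting_of_mem_support_glAct ht).valid x.2 y.2⟩, rfl⟩

theorem support_insertAll_subset_range (t : Tree d κ ι) (a : NegMon d β α) :
    ↑(insertAll K t.1 (factors a)).support ⊆
      Set.range (Subtype.val : Tree d κ ι → PTree d κ ι) := fun z hz =>
  ⟨⟨z, (isInsertion_of_mem_support_insertAll hz).valid t.2 fun _ => valid_of_mem_factors⟩, rfl⟩

theorem support_insertAllNonRoot_subset_range (t : Tree d κ ι) (a : NegMon d β α) :
    ↑(insertAllNonRoot K t.1 (factors a)).support ⊆
      Set.range (Subtype.val : Tree d κ ι → PTree d κ ι) := fun z hz =>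
  ⟨⟨z, (isNonRootInsertion_of_mem_support_insertAllNonRoot hz).valid t.2
    fun _ => valid_of_mem_factors⟩, rfl⟩

theorem deltaPlusZero_apply (z : Tree d κ ι) (p : Tree d κ ι × Tree d κ ι) :
    deltaPlusZero K z p = glAct K p.1.1 p.2.1 z.1 := by
  rw [deltaPlusZero]
  split_ifs with h
  · rfl
  · rw [glAct_eq_zero h, Finsupp.zero_apply]

theorem deltaMinus_apply (z : Tree d κ ι) (p : NegMon d β α × Tree d κ ι) :
    deltaMinus K β α z p =
      (monFactorial K p.1)⁻¹ * insertAll K p.2.1 (factors p.1) z.1 := by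
  rw [deltaMinus, dualCoaction, actMon_insertion, monFactorial]

theorem deltaMinusNonRoot_apply (z : Tree d κ ι) (p : NegMon d β α × Tree d κ ι) :
    deltaMinusNonRoot K β α z p =
      (monFactorial K p.1)⁻¹ * insertAllNonRoot K p.2.1 (factors p.1) z.1 := by
  rw [deltaMinusNonRoot, dualCoaction, actMon_insertionNonRoot, monFactorial]

theorem mem_support_glAct_of_deltaPlusZero_ne_zero {z : Tree d κ ι}
    {p : Tree d κ ι × Tree d κ ι} (h : deltaPlusZero K z p ≠ 0) :
    z.1 ∈ (glAct K p.1.1 p.2.1).support := by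
  rwa [deltaPlusZero_apply, ← Finsupp.mem_support_iff] at h

theorem mem_support_insertAll_of_deltaMinus_ne_zero {z : Tree d κ ι}
    {p : NegMon d β α × Tree d κ ι} (h : deltaMinus K β α z p ≠ 0) :
    z.1 ∈ (insertAll K p.2.1 (factors p.1)).support := by
  rw [deltaMinus_apply] at h
  exact Finsupp.mem_support_iff.2 (right_ne_zero_of_mul h)

theorem mem_support_insertAllNonRoot_of_deltaMinusNonRoot_ne_zero {z : Tree d κ ι}
    {p : NegMon d β α × Tree d κ ι} (h : deltaMinusNonRoot K β α z p ≠ 0) :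
    z.1 ∈ (insertAllNonRoot K p.2.1 (factors p.1)).support := by
  rw [deltaMinusNonRoot_apply] at h
  exact Finsupp.mem_support_iff.2 (right_ne_zero_of_mul h)

theorem finite_support_deltaMinus (z : Tree d κ ι) :
    (Function.support (deltaMinus K β α z)).Finite :=
  (finite_setOf_isInsertion β α z.1).subset fun _ hp =>
    isInsertion_of_mem_support_insertAll (mem_support_insertAll_of_deltaMinus_ne_zero hp)

theorem finite_support_deltaMinusNonRoot (z : Tree d κ ι) :
    (Function.support (deltaMinusNonRoot K β α z)).Finite :=
  (finite_setOf_isInsertion β α z.1).subset fun _ hp =>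
    (isNonRootInsertion_of_mem_support_insertAllNonRoot
      (mem_support_insertAllNonRoot_of_deltaMinusNonRoot_ne_zero hp)).toIsInsertion

theorem extends_idMap_deltaPlusZero (A : Type*) :
    Extends K (idMap K A) (deltaPlusZero K (d := d) (κ := κ) (ι := ι)) := fun a e =>
  ((Set.finite_singleton a).prod ((glAct K e.1.1 e.2.1).support.finite_toSet.preimage
    Subtype.val_injective.injOn)).subset fun _ hp =>
      ⟨of_not_not fun h => left_ne_zero_of_mul hp (if_neg h),
        mem_support_glAct_of_deltaPlusZero_ne_zero (right_ne_zero_of_mul hp)⟩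

theorem extends_deltaMinusNonRoot_deltaMinus :
    Extends K (deltaMinusNonRoot K (d := d) β α) (deltaMinus K (d := d) β α) := fun b e =>
  (((insertAllNonRoot K b.2.1 (factors b.1)).support.finite_toSet.preimage
    Subtype.val_injective.injOn).prod
      ((insertAll K e.2.1 (factors e.1)).support.finite_toSet.preimage
        Subtype.val_injective.injOn)).subset fun _ hp =>
        ⟨mem_support_insertAllNonRoot_of_deltaMinusNonRoot_ne_zero (left_ne_zero_of_mul hp),
          mem_support_insertAll_of_deltaMinus_ne_zero (right_ne_zero_of_mul hp)⟩

/-- The pairing with a fixed linear combination of trees. -/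
def pairing (w : Tree d κ ι →₀ K) : (PTree d κ ι →₀ K) →ₗ[K] K :=
  ∑ z ∈ w.support, w z • Finsupp.lapply z.1

theorem pairing_apply (w : Tree d κ ι →₀ K) (e : PTree d κ ι →₀ K) :
    pairing w e = ∑ z ∈ w.support, w z * e z.1 := by
  simp [pairing]

theorem lin_deltaMinus_apply (w : Tree d κ ι →₀ K) (p : NegMon d β α × Tree d κ ι) :
    lin K (deltaMinus K β α) w p =
      (monFactorial K p.1)⁻¹ * pairing w (insertAll K p.2.1 (factors p.1)) := by
  simp only [lin, Finsupp.linearCombination_apply, Finsupp.sum, Finset.sum_apply, Pi.smul_apply,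
    smul_eq_mul, deltaMinus_apply, pairing_apply, Finset.mul_sum, mul_left_comm]

theorem lin_deltaPlusZero_apply (w : Tree d κ ι →₀ K) (p : Tree d κ ι × Tree d κ ι) :
    lin K (deltaPlusZero K) w p = pairing w (glAct K p.1.1 p.2.1) := by
  simp only [lin, Finsupp.linearCombination_apply, Finsupp.sum, Finset.sum_apply, Pi.smul_apply,
    smul_eq_mul, deltaPlusZero_apply, pairing_apply]

theorem tensorMap_idMap_deltaPlusZero_apply (w : Tree d κ ι →₀ K) (a : NegMon d β α)
    (x y : Tree d κ ι) :
    tensorMap K (idMap K (NegMon d β α)) (deltaPlusZero K) (lin K (deltaMinus K β α) w)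
        (a, x, y) =
      (monFactorial K a)⁻¹ *
        pairing w (bind (glAct K x.1 y.1) fun t => insertAll K t (factors a)) := by
  rw [tensorMap_idMap]
  simp only [lin_deltaMinus_apply, deltaPlusZero_apply]
  rw [finsum_mul_eq_bind Subtype.val_injective (support_glAct_subset_range x y)
    fun t => (monFactorial K a)⁻¹ * pairing w (insertAll K t (factors a)), map_bind]
  exact bind_fun_smul _ _ _

theorem tensorMap_deltaMinusNonRoot_deltaMinus_apply (w : Tree d κ ι →₀ K)
    (b c : NegMon d β α) (x y : Tree d κ ι) :
    tensorMap K (deltaMinusNonRoot K β α) (deltaMinus K β α) (lin K (deltaPlusZero K) w)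
        ((b, x), (c, y)) =
      (monFactorial K b)⁻¹ * (monFactorial K c)⁻¹ *
        pairing w (bind (insertAllNonRoot K x.1 (factors b)) fun x' =>
          bind (insertAll K y.1 (factors c)) fun y' => glAct K x' y') := by
  have bind_eq := finsum_mul_mul_eq_bind Subtype.val_injective
    (support_insertAllNonRoot_subset_range (K := K) x b) Subtype.val_injective
    (support_insertAll_subset_range (K := K) y c)
    fun u v => ((monFactorial K b)⁻¹ * (monFactorial K c)⁻¹) • pairing w (glAct K u v)
  rw [← smul_eq_mul (_ * _)]
  simp only [map_bind, ← bind_fun_smul]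
  rw [← bind_eq, tensorMap]
  refine finsum_congr fun p => ?_
  rw [lin_deltaPlusZero_apply, deltaMinus_apply, deltaMinusNonRoot_apply]
  ring

theorem cointeraction [CharZero K] (w : Tree d κ ι →₀ K) :
    tensorMap K (idMap K (NegMon d β α)) (deltaPlusZero K) (lin K (deltaMinus K β α) w) =
      mul13 K (tensorMap K (deltaMinusNonRoot K β α) (deltaMinus K β α)
        (lin K (deltaPlusZero K) w)) := by
  funext ⟨a, x, y⟩
  have dual_identity := insertAll_glAct (K := K) x.1 y.1 (factors a) fun u =>
    Finsupp.single u (1 : K)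
  simp only [bind_single_one] at dual_identity
  rw [tensorMap_idMap_deltaPlusZero_apply, dual_identity, factors, bind₂_splitMon_toMultiset,
    map_smul, smul_eq_mul, inv_mul_cancel_left₀ (monFactorial_ne_zero K a), mul13]
  simp only [tensorMap_deltaMinusNonRoot_deltaMinus_apply, map_sum, map_smul, smul_eq_mul, factors]

end Coactions

end PlanarRS

end

theorem mainTheorem3 {K : Type*} [Field K] [CharZero K] {d : ℕ} {κ ι : Type*}
    (β : κ → ℝ) (α : ι → ℝ) :
    -- the actions of products of negative trees do not depend on the order of the factors
    (∀ (n : ℕ) (τ : Fin n → PlanarRS.NegTree d β α) (π : Equiv.Perm (Fin n))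
        (t : PlanarRS.Tree d κ ι),
      PlanarRS.act K (PlanarRS.insertion K) n (fun i => (τ (π i)).1) t.1 =
          PlanarRS.act K (PlanarRS.insertion K) n (fun i => (τ i).1) t.1 ∧
      PlanarRS.act K (PlanarRS.insertionNonRoot K) n (fun i => (τ (π i)).1) t.1 =
          PlanarRS.act K (PlanarRS.insertionNonRoot K) n (fun i => (τ i).1) t.1) ∧
    -- the renormalisation coactions take values in the algebraic tensor product
    (∀ z : PlanarRS.Tree d κ ι,
      (Function.support (PlanarRS.deltaMinus K β α z)).Finite ∧
      (Function.support (PlanarRS.deltaMinusNonRoot K β α z)).Finite) ∧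
    -- the tensor products of maps below are well defined on completed tensor products
    PlanarRS.Extends K (PlanarRS.idMap K (PlanarRS.NegMon d β α))
      (PlanarRS.deltaPlusZero K (d := d) (κ := κ) (ι := ι)) ∧
    PlanarRS.Extends K (PlanarRS.deltaMinusNonRoot K (d := d) β α)
      (PlanarRS.deltaMinus K (d := d) β α) ∧
    -- cointeraction
    ∀ w : PlanarRS.Tree d κ ι →₀ K,
      PlanarRS.tensorMap K (PlanarRS.idMap K (PlanarRS.NegMon d β α)) (PlanarRS.deltaPlusZero K)
          (PlanarRS.lin K (PlanarRS.deltaMinus K β α) w) =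
        PlanarRS.mul13 K
          (PlanarRS.tensorMap K (PlanarRS.deltaMinusNonRoot K β α) (PlanarRS.deltaMinus K β α)
            (PlanarRS.lin K (PlanarRS.deltaPlusZero K) w)) :=
  ⟨fun n τ π t => by
      have perm : (fun i => (τ (π i)).1) = (fun i => (τ i).1) ∘ π := rfl
      have factors_eq := Multiset.coe_eq_coe.2 (π.ofFn_comp_perm fun i => (τ i).1)
      simp only [perm, PlanarRS.act_insertion, PlanarRS.act_insertionNonRoot, factors_eq,
        and_self],
    fun z => ⟨PlanarRS.finite_support_deltaMinus z, PlanarRS.finite_support_deltaMinusNonRoot z⟩,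
    PlanarRS.extends_idMap_deltaPlusZero _, PlanarRS.extends_deltaMinusNonRoot_deltaMinus,
    PlanarRS.cointeraction⟩
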